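/- Let $\mathbb{C}_+=\{s\in\mathbb{C}:\operatorname{Re}s>0\}$ and let $\mathcal{A}(\mathbb{C}_+)$ be the set of Dirichlet series $f(s)=\sum_{n\ge1}a_n n^{-s}$ which converge at every point of $\mathbb{C}_+$ and whose sum is uniformly continuous on $\mathbb{C}_+$. For $t\in\mathbb{R}$ let $f(it)$ be the limit of $f(s)$ as $s\to it$, $s\in\mathbb{C}_+$. Let $p_1<p_2<\dots$ be the primes and let $\mathbb{T}^\infty$ be the infinite polytorus with the product topology. The Bohr lift of $f$ is the power series $F(z)=\sum_{n\ge1}a_n z_1^{\alpha_1}z_2^{\alpha_2}\cdots$, where $n=p_1^{\alpha_1}p_2^{\alpha_2}\cdots$; it is a function on the set of points of $\mathbb{D}^\infty$ with finitely many nonzero coordinates, and for $z\in\mathbb{T}^\infty$, $F(z)$ denotes its limit as the argument tends to $z$ (coordinatewise) inside that set. For every $f\in\mathcal{A}(\mathbb{C}_+)$ all these limits exist, and $t\mapsto f(it)$ and $F:\mathbb{T}^\infty\to\mathbb{C}$ are continuous. Moreover: (i) For every Borel probability measure $\mu$ on $\mathbb{T}^\infty$ there is a locally finite Borel measure $\lambda$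 on $\mathbb{R}$ such that $\lambda([0,T])>0$ for all large $T$ and, for all $f\in\mathcal{A}(\mathbb{C}_+)$, $$\lim_{T\to\infty}\frac{1}{\lambda([0,T])}\int_{[0,T]}|f(it)|^2\,d\lambda(t)=\int_{\mathbb{T}^\infty}|F(z)|^2\,d\mu(z).\qquad(*)$$ (ii) Conversely, let $\lambda$ be a locally finite Borel measure on $\mathbb{R}$ with $\lambda([0,T])>0$ for all large $T$, such that the limit on the left-hand side of $(*)$ exists and is finite for every $f\in\mathcal{A}(\mathbb{C}_+)$. Then there is a unique Borel probability measure $\mu$ on $\mathbb{T}^\infty$ such that $(*)$ holds for all $f\in\mathcal{A}(\mathbb{C}_+)$. -/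

import Mathlib

open Filter Topology MeasureTheory

/-- The Borel σ-algebra of the unit circle; the polytorus `𝕋^∞ = ℕ → Circle` then carries the
product σ-algebra, which is its Borel σ-algebra. -/
noncomputable instance instMeasurableSpaceCircle : MeasurableSpace Circle := borel Circle

instance instBorelSpaceCircle : BorelSpace Circle := ⟨rfl⟩

/-- The open right half plane `ℂ₊`. -/
def rightHalfPlane : Set ℂ := {s : ℂ | 0 < s.re}

/-- `f` is (on `ℂ₊`) the Dirichlet series `∑_{n ≥ 1} a n * n ^ (-s)`, and belongs to the space
`𝒜(ℂ₊)`: the series converges at every point of `ℂ₊` (as the limit of its partial sums, possibly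
only conditionally), and its sum is uniformly continuous on `ℂ₊`.
The values `a 0` and `f s` for `s ∉ ℂ₊` play no role. -/
structure IsUniformDirichletSeries (a : ℕ → ℂ) (f : ℂ → ℂ) : Prop where
  converges : ∀ s ∈ rightHalfPlane,
    Tendsto (fun N : ℕ => ∑ n ∈ Finset.Icc 1 N, a n * (n : ℂ) ^ (-s)) atTop (𝓝 (f s))
  uniformContinuousOn : UniformContinuousOn f rightHalfPlane

/-- The value `f(it)` on the imaginary axis of a function `f` on `ℂ₊`: the limit of `f(s)` as
`s → it` inside `ℂ₊`. -/
noncomputable def boundaryValue (f : ℂ → ℂ) (t : ℝ) : ℂ :=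
  extendFrom rightHalfPlane f (t * Complex.I)

/-- The monomial `∏ⱼ zⱼ ^ αⱼ`, where `n = ∏ⱼ pⱼ ^ αⱼ` and `p₀ < p₁ < …` are the primes
(`Nat.primeCounting' p` is the number of primes below `p`, that is, the `j` with `p = pⱼ`). -/
noncomputable def bohrMonomial (n : ℕ) (z : ℕ → ℂ) : ℂ :=
  n.factorization.prod fun p k => z (Nat.primeCounting' p) ^ k

/-- The points of the infinite polydisk `𝔻^∞` with finitely many nonzero coordinates. -/
def finitePolydisk : Set (ℕ → ℂ) := {w | (∀ j, ‖w j‖ < 1) ∧ {j | w j ≠ 0}.Finite}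

/-- The power series `∑_{n ≥ 1} a n * z₁^α₁ z₂^α₂ ⋯` (with `n = p₁^α₁ p₂^α₂ ⋯`) that corresponds to
the Dirichlet series `∑_{n ≥ 1} a n * n ^ (-s)` through `zⱼ = pⱼ ^ (-s)`. -/
noncomputable def bohrPowerSeries (a : ℕ → ℂ) (w : ℕ → ℂ) : ℂ :=
  ∑' n : ℕ+, a n * bohrMonomial n w

/-- The Bohr lift on the infinite polytorus `𝕋^∞`: the boundary values there of the power series
on the polydisk, for the product topology. -/
noncomputable def bohrLift (a : ℕ → ℂ) (z : ℕ → Circle) : ℂ :=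
  extendFrom finitePolydisk (bohrPowerSeries a) (fun j => (z j : ℂ))

/-- The mean `(1 / ν[0,T]) ∫_{[0,T]} |f(it)|² dν(t)` is meaningful for all large `T`, and tends
to `L` as `T → ∞`. -/
def HasQuadraticMean (ν : Measure ℝ) (f : ℂ → ℂ) (L : ℝ) : Prop :=
  (∀ᶠ T : ℝ in atTop, 0 < ν (Set.Icc 0 T)) ∧
  Tendsto (fun T : ℝ => (1 / ν.real (Set.Icc 0 T)) *
    ∫ t in Set.Icc 0 T, ‖boundaryValue f t‖ ^ 2 ∂ν) atTop (𝓝 L)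

/-! Everything rests on the identity `f(it) = F(p_j^(-it))`: boundary values of `f` are values of a
continuous function on the compact polytorus along the flow `primeFlow`. The quadratic mean over
`[0, T]` is therefore the integral of `|F|^2` against the law of the flow at a random time in `[0,
T]` (`primeFlowLaw`), and both halves become statements about weak convergence of these laws. By
compactness and Stone–Weierstrass, weak convergence is convergence of Fourier coefficients.

Existence of `F`: smoothing `f` along vertical lines with a kernel of compactly supported Fourier
transform gives Dirichlet polynomials converging to `f` uniformly on the half plane. The flow is
dense (Kronecker), so by the maximum principle the supremum of a Dirichlet polynomial on the half
plane bounds its lift on the whole closed polydisk (Bohr). The lifts thus converge uniformly there,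
to a continuous extension of the power series.

(i) By the strong law of large numbers, `μ` has an equidistributed sequence `z_k`. The flow enters
every nonempty open set at arbitrarily late times, so there are times `t_k`, at least 1 apart, at
which it is close to `z_k`. The sum of Dirac masses at the `t_k` is the required measure.

(ii) Polarization, applied to `m^(-s) + c n^(-s)` with `c = 1` and `c = i`, recovers every Fourier
coefficient from quadratic means. The coefficients of the laws therefore converge, a cluster point
of the laws has the limits as coefficients, and this determines `μ`. -/

/-! ### Monomials indexed by integers -/

section Monomials

theorem bohrMonomial_mul {m n : ℕ} (hm : m ≠ 0) (hn : n ≠ 0) (w : ℕ → ℂ) :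
    bohrMonomial (m * n) w = bohrMonomial m w * bohrMonomial n w := by
  rw [bohrMonomial, Nat.factorization_mul hm hn,
    Finsupp.prod_add_index' (by simp) (by intros; rw [pow_add])]
  rfl

@[simp]
theorem bohrMonomial_one (w : ℕ → ℂ) : bohrMonomial 1 w = 1 := by simp [bohrMonomial]

theorem bohrMonomial_mul_right (n : ℕ) (w v : ℕ → ℂ) :
    bohrMonomial n (fun j => w j * v j) = bohrMonomial n w * bohrMonomial n v := by
  simp [bohrMonomial, Finsupp.prod, mul_pow, Finset.prod_mul_distrib]

theorem bohrMonomial_prime {p : ℕ} (hp : p.Prime) (w : ℕ → ℂ) :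
    bohrMonomial p w = w (Nat.primeCounting' p) := by
  simp [bohrMonomial, hp.factorization]

theorem bohrMonomial_nth_prime (j : ℕ) (w : ℕ → ℂ) :
    bohrMonomial (Nat.nth Nat.Prime j) w = w j := by
  rw [bohrMonomial_prime (Nat.prime_nth_prime j), Nat.primeCounting'_nth_eq]

theorem continuous_bohrMonomial (n : ℕ) : Continuous (bohrMonomial n) := by
  unfold bohrMonomial Finsupp.prod
  fun_prop

theorem norm_bohrMonomial (n : ℕ) (w : ℕ → ℂ) :
    ‖bohrMonomial n w‖ = n.factorization.prod fun p k => ‖w (Nat.primeCounting' p)‖ ^ k := by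
  simp [bohrMonomial, Finsupp.prod]

theorem norm_bohrMonomial_circle (n : ℕ) (z : ℕ → Circle) :
    ‖bohrMonomial n (fun j => (z j : ℂ))‖ = 1 := by
  simp only [norm_bohrMonomial, Circle.norm_coe, one_pow, Finsupp.prod, Finset.prod_const_one]

end Monomials

/-! ### The Kronecker flow on the polytorus -/

section PrimeFlow

/-- The point `(p_j ^ (-it))_j` of the polytorus. -/
noncomputable def primeFlow (t : ℝ) : ℕ → Circle :=
  fun j => Circle.exp (-(t * Real.log (Nat.nth Nat.Prime j)))

theorem continuous_primeFlow : Continuous primeFlow := by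
  unfold primeFlow
  fun_prop

theorem primeFlow_add (s t : ℝ) : primeFlow (s + t) = primeFlow s * primeFlow t := by
  ext j
  simp only [primeFlow, Pi.mul_apply, ← Circle.exp_add]
  congr 2
  ring

theorem primeFlow_zero : primeFlow 0 = 1 := by
  ext j
  simp [primeFlow]

theorem primeFlow_nat (m : ℕ) : primeFlow m = primeFlow 1 ^ m := by
  induction m with
  | zero => simp [primeFlow_zero]
  | succ k ih => rw [Nat.cast_succ, primeFlow_add, ih, pow_succ]

/-- Both sides are completely multiplicative in `n`, so primes decide. -/
theorem bohrMonomial_primeFlow {n : ℕ} (hn : n ≠ 0) (t : ℝ) :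
    bohrMonomial n (fun j => (primeFlow t j : ℂ)) = (n : ℂ) ^ (-(t * Complex.I)) := by
  induction n using Nat.recOnMul with
  | zero => exact absurd rfl hn
  | one => simp
  | prime p hp =>
    rw [bohrMonomial_prime hp, primeFlow, Circle.coe_exp, Nat.primeCounting',
      Nat.nth_count hp, Complex.cpow_def_of_ne_zero (by exact_mod_cast hn),
      ← Complex.natCast_log]
    congr 1
    push_cast
    ring
  | mul a b iha ihb =>
    have ha : a ≠ 0 := by rintro rfl; simp at hn
    have hb : b ≠ 0 := by rintro rfl; simp at hn
    rw [bohrMonomial_mul ha hb, iha ha, ihb hb, Nat.cast_mul,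
      Complex.natCast_mul_natCast_cpow]

end PrimeFlow

/-! ### Fourier analysis on the polytorus and unique ergodicity -/

section Characters

/-- The character `z ↦ χ_m(z) * conj (χ_n(z))` of the polytorus, where `χ_m` is the monomial
with exponents given by the factorization of `m`. -/
noncomputable def torusCharacter (q : ℕ+ × ℕ+) (z : ℕ → Circle) : ℂ :=
  bohrMonomial q.1 (fun j => (z j : ℂ)) * star (bohrMonomial q.2 (fun j => (z j : ℂ)))

theorem continuous_torusCharacter (q : ℕ+ × ℕ+) : Continuous (torusCharacter q) := by
  have h (n : ℕ) : Continuous fun z : ℕ → Circle => bohrMonomial n (fun j => (z j : ℂ)) :=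
    (continuous_bohrMonomial n).comp (by fun_prop)
  exact (h _).mul (h _).star

theorem norm_torusCharacter (q : ℕ+ × ℕ+) (z : ℕ → Circle) : ‖torusCharacter q z‖ = 1 := by
  simp [torusCharacter, norm_bohrMonomial_circle]

theorem torusCharacter_mul (q r : ℕ+ × ℕ+) (z : ℕ → Circle) :
    torusCharacter (q * r) z = torusCharacter q z * torusCharacter r z := by
  simp only [torusCharacter, Prod.fst_mul, Prod.snd_mul, PNat.mul_coe,
    bohrMonomial_mul (PNat.ne_zero _) (PNat.ne_zero _), star_mul']
  ring

theorem torusCharacter_mul_right (q : ℕ+ × ℕ+) (z w : ℕ → Circle) :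
    torusCharacter q (z * w) = torusCharacter q z * torusCharacter q w := by
  simp only [torusCharacter, Pi.mul_apply, Circle.coe_mul, bohrMonomial_mul_right, star_mul']
  ring

theorem star_torusCharacter (q : ℕ+ × ℕ+) (z : ℕ → Circle) :
    star (torusCharacter q z) = torusCharacter q.swap z := by
  simp [torusCharacter, mul_comm]

theorem torusCharacter_self (n : ℕ+) (z : ℕ → Circle) : torusCharacter (n, n) z = 1 := by
  have := norm_bohrMonomial_circle n z
  simp only [torusCharacter, RCLike.star_def, Complex.mul_conj', this]
  simp

theorem torusCharacter_nth_prime (j : ℕ) (z : ℕ → Circle) :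
    torusCharacter (⟨Nat.nth Nat.Prime j, (Nat.prime_nth_prime j).pos⟩, 1) z = z j := by
  simp [torusCharacter, bohrMonomial_nth_prime]

theorem integrable_torusCharacter (q : ℕ+ × ℕ+) (μ : Measure (ℕ → Circle)) [IsFiniteMeasure μ] :
    Integrable (torusCharacter q) μ :=
  .of_bound (continuous_torusCharacter q).aestronglyMeasurable 1
    (.of_forall fun z => (norm_torusCharacter q z).le)

/-- The character as a bounded continuous function. -/
noncomputable def torusCharacterBCF (q : ℕ+ × ℕ+) : BoundedContinuousFunction (ℕ → Circle) ℂ :=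
  BoundedContinuousFunction.mkOfCompact ⟨torusCharacter q, continuous_torusCharacter q⟩

/-- The star algebra of trigonometric polynomials on the polytorus. -/
noncomputable def torusCharacterAlgebra :
    StarSubalgebra ℂ (BoundedContinuousFunction (ℕ → Circle) ℂ) where
  toSubalgebra := Algebra.adjoin ℂ (Set.range torusCharacterBCF)
  star_mem' := by
    change Algebra.adjoin ℂ (Set.range torusCharacterBCF) ≤
      star (Algebra.adjoin ℂ (Set.range torusCharacterBCF))
    refine Algebra.adjoin_le ?_
    rintro - ⟨q, rfl⟩
    refine Algebra.subset_adjoin ⟨q.swap, ?_⟩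
    ext z
    exact (star_torusCharacter q z).symm

/-- Products of characters are characters, so an identity between integrals over the algebra need
only be checked on characters. -/
theorem torusCharacterAlgebra_eq_span :
    Subalgebra.toSubmodule torusCharacterAlgebra.toSubalgebra
      = Submodule.span ℂ (Set.range torusCharacterBCF) := by
  apply Algebra.adjoin_eq_span_of_subset
  refine Set.Subset.trans ?_ Submodule.subset_span
  intro x hx
  refine Submonoid.closure_induction (fun _ => id) ⟨1, ?_⟩ ?_ hx
  · ext1 z; exact torusCharacter_self 1 z
  · rintro - - - - ⟨m, rfl⟩ ⟨n, rfl⟩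
    refine ⟨m * n, ?_⟩
    ext1 z
    exact torusCharacter_mul m n z

/-- A finite measure on the polytorus is determined by its Fourier coefficients. -/
theorem ext_of_integral_torusCharacter_eq {μ ν : Measure (ℕ → Circle)} [IsFiniteMeasure μ]
    [IsFiniteMeasure ν]
    (h : ∀ q, ∫ z, torusCharacter q z ∂μ = ∫ z, torusCharacter q z ∂ν) : μ = ν := by
  have : PolishSpace Circle := inferInstanceAs (PolishSpace (Metric.sphere (0 : ℂ) 1))
  refine ext_of_forall_mem_subalgebra_integral_eq_of_polish (𝕜 := ℂ)
    (A := torusCharacterAlgebra) ?_ ?_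
  · intro x y hxy
    obtain ⟨j, hj⟩ := Function.ne_iff.1 hxy
    -- The coordinates are characters, so characters separate points.
    let q : ℕ+ × ℕ+ := (⟨Nat.nth Nat.Prime j, (Nat.prime_nth_prime j).pos⟩, 1)
    refine ⟨torusCharacter q, ⟨⟨torusCharacter q, continuous_torusCharacter q⟩,
      ⟨torusCharacterBCF q, Algebra.subset_adjoin ⟨q, rfl⟩, rfl⟩, rfl⟩, ?_⟩
    simpa [q, torusCharacter_nth_prime, Circle.ext_iff] using hj
  · intro g hg
    have hg' : g ∈ Submodule.span ℂ (Set.range torusCharacterBCF) := by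
      rw [← torusCharacterAlgebra_eq_span]; exact hg
    induction hg' using Submodule.span_induction with
    | mem x hx => obtain ⟨q, rfl⟩ := hx; exact h q
    | zero => simp
    | add x y hx hy ihx ihy =>
      simp only [BoundedContinuousFunction.coe_add, Pi.add_apply]
      rw [integral_add (x.integrable _) (y.integrable _),
        integral_add (x.integrable _) (y.integrable _), ihx, ihy]
      · rw [← torusCharacterAlgebra_eq_span] at hy; exact hy
      · rw [← torusCharacterAlgebra_eq_span] at hx; exact hx
    | smul c x hx ihx =>
      simp only [BoundedContinuousFunction.coe_smul]
      rw [integral_smul, integral_smul, ihx]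
      rw [← torusCharacterAlgebra_eq_span] at hx; exact hx

/-- Along the flow the character oscillates with frequency `log m - log n ≠ 0`; after half a period
its value is `-1`. -/
theorem exists_torusCharacter_primeFlow_ne_one {q : ℕ+ × ℕ+} (hq : q.1 ≠ q.2) :
    ∃ t, torusCharacter q (primeFlow t) ≠ 1 := by
  by_contra! H
  have hlog : Real.log q.1 - Real.log q.2 ≠ 0 := by
    rw [sub_ne_zero]
    intro h
    refine hq (PNat.coe_injective ?_)
    exact_mod_cast Real.log_injOn_pos (Set.mem_Ioi.2 (by exact_mod_cast q.1.pos))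
      (Set.mem_Ioi.2 (by exact_mod_cast q.2.pos)) h
  have key (t : ℝ) : torusCharacter q (primeFlow t)
      = Complex.exp (-((Real.log q.1 - Real.log q.2 : ℝ) * t * Complex.I)) := by
    rw [torusCharacter, bohrMonomial_primeFlow q.1.ne_zero, bohrMonomial_primeFlow q.2.ne_zero,
      Complex.cpow_def_of_ne_zero (by exact_mod_cast q.1.ne_zero),
      Complex.cpow_def_of_ne_zero (by exact_mod_cast q.2.ne_zero), RCLike.star_def,
      ← Complex.exp_conj, ← Complex.exp_add, ← Complex.natCast_log,
      ← Complex.natCast_log]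
    congr 1
    simp only [map_neg, map_mul, Complex.conj_ofReal, Complex.conj_I, Complex.ofReal_sub]
    ring
  have := H (Real.pi / (Real.log q.1 - Real.log q.2))
  rw [key] at this
  have h2 : -(((Real.log q.1 - Real.log q.2 : ℝ) : ℂ)
      * ((Real.pi / (Real.log q.1 - Real.log q.2) : ℝ) : ℂ) * Complex.I)
      = -(Real.pi * Complex.I) := by
    rw [← Complex.ofReal_mul, mul_div_cancel₀ _ hlog]
  rw [h2, Complex.exp_neg, Complex.exp_pi_mul_I] at this
  norm_num at this

/-- Translation by the flow multiplies the integral by the value of the character there, which for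
some time is not 1. -/
theorem integral_torusCharacter_eq_zero {q : ℕ+ × ℕ+} (hq : q.1 ≠ q.2)
    {μ : Measure (ℕ → Circle)} (hμ : ∀ t, μ.map (primeFlow t * ·) = μ) :
    ∫ z, torusCharacter q z ∂μ = 0 := by
  obtain ⟨t, ht⟩ := exists_torusCharacter_primeFlow_ne_one hq
  have h : ∫ z, torusCharacter q z ∂μ
      = torusCharacter q (primeFlow t) * ∫ z, torusCharacter q z ∂μ := by
    conv_lhs => rw [← hμ t]
    rw [integral_map (by fun_prop) (continuous_torusCharacter q).aestronglyMeasurable]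
    simp_rw [torusCharacter_mul_right]
    exact integral_const_mul _ _
  have h2 : (1 - torusCharacter q (primeFlow t)) * ∫ z, torusCharacter q z ∂μ = 0 := by
    rw [sub_mul, one_mul, ← h, sub_self]
  exact (mul_eq_zero.1 h2).resolve_left (sub_ne_zero.2 ht.symm)

/-- The prime flow is uniquely ergodic. -/
theorem eq_of_primeFlow_invariant {μ ν : Measure (ℕ → Circle)} [IsProbabilityMeasure μ]
    [IsProbabilityMeasure ν] (hμ : ∀ t, μ.map (primeFlow t * ·) = μ)
    (hν : ∀ t, ν.map (primeFlow t * ·) = ν) : μ = ν := by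
  refine ext_of_integral_torusCharacter_eq fun q => ?_
  by_cases hq : q.1 = q.2
  · obtain ⟨m, n⟩ := q
    obtain rfl : m = n := hq
    simp [torusCharacter_self]
  · rw [integral_torusCharacter_eq_zero hq hμ, integral_torusCharacter_eq_zero hq hν]

end Characters

/-! ### Density and recurrence of the flow -/

section Kronecker

/-- Normalized Haar measure of the polytorus. -/
noncomputable def torusHaar : Measure (ℕ → Circle) :=
  Measure.haarMeasure ⊤

instance isHaarMeasure_torusHaar : torusHaar.IsHaarMeasure := by
  unfold torusHaar; infer_instance

instance isProbabilityMeasure_torusHaar : IsProbabilityMeasure torusHaar :=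
  ⟨Measure.haarMeasure_self (K₀ := (⊤ : TopologicalSpace.PositiveCompacts (ℕ → Circle)))⟩

theorem map_primeFlow_torusHaar (t : ℝ) : torusHaar.map (primeFlow t * ·) = torusHaar :=
  map_mul_left_eq_self _ _

/-- The prime flow is dense in the polytorus. -/
theorem denseRange_primeFlow : DenseRange primeFlow := by
  let R : Subgroup (ℕ → Circle) :=
    { carrier := Set.range primeFlow
      one_mem' := ⟨0, primeFlow_zero⟩
      mul_mem' := by
        rintro - - ⟨s, rfl⟩ ⟨t, rfl⟩
        exact ⟨s + t, primeFlow_add s t⟩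
      inv_mem' := by
        rintro - ⟨s, rfl⟩
        refine ⟨-s, eq_inv_of_mul_eq_one_left ?_⟩
        rw [← primeFlow_add, neg_add_cancel, primeFlow_zero] }
  let H : Subgroup (ℕ → Circle) := R.topologicalClosure
  have hH : IsClosed (H : Set (ℕ → Circle)) := R.isClosed_topologicalClosure
  have hmem (t : ℝ) : primeFlow t ∈ H := R.le_topologicalClosure ⟨t, rfl⟩
  have : CompactSpace H := isCompact_iff_compactSpace.1 hH.isCompact
  -- Haar measure of the closure `H` of the flow is flow-invariant, hence by unique ergodicity equal
  -- to Haar measure of the torus. The open complement of `H` is then null, so empty.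
  let m : Measure H := Measure.haarMeasure ⊤
  have : IsProbabilityMeasure m :=
    ⟨by simpa using Measure.haarMeasure_self (K₀ := (⊤ : TopologicalSpace.PositiveCompacts H))⟩
  have : IsProbabilityMeasure (m.map (Subtype.val : H → (ℕ → Circle))) :=
    Measure.isProbabilityMeasure_map (by fun_prop)
  have h : m.map (Subtype.val : H → (ℕ → Circle)) = torusHaar := by
    refine eq_of_primeFlow_invariant (fun t => ?_) map_primeFlow_torusHaar
    rw [Measure.map_map (by fun_prop) (by fun_prop)]
    have : (fun x => primeFlow t * x) ∘ (Subtype.val : H → (ℕ → Circle))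
        = Subtype.val ∘ fun x : H => (⟨primeFlow t, hmem t⟩ : H) * x := rfl
    rw [this, ← Measure.map_map (by fun_prop) (by fun_prop), map_mul_left_eq_self]
  have hc : torusHaar (H : Set (ℕ → Circle))ᶜ = 0 := by
    rw [← h, Measure.map_apply (by fun_prop) hH.measurableSet.compl, Set.preimage_compl,
      Subtype.coe_preimage_self, Set.compl_univ, measure_empty]
  have he := (hH.isOpen_compl.measure_eq_zero_iff torusHaar).1 hc
  rw [DenseRange, dense_iff_closure_eq]
  change (H : Set (ℕ → Circle)) = Set.univ
  exact Set.compl_empty_iff.1 he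

/-- The prime flow visits every nonempty open set at arbitrarily large times. -/
theorem exists_primeFlow_mem {U : Set (ℕ → Circle)} (hU : IsOpen U) (hne : U.Nonempty) (T : ℝ) :
    ∃ t ≥ T, primeFlow t ∈ U := by
  obtain ⟨t₀, ht₀⟩ := denseRange_primeFlow.exists_mem_open hU hne
  have hW : {g | g * primeFlow t₀ ∈ U} ∈ 𝓝 (1 : ℕ → Circle) :=
    (hU.preimage (by fun_prop)).mem_nhds (by simpa using ht₀)
  obtain ⟨V, hV, hV1, hVV⟩ := exists_open_nhds_one_split hW
  let V' := V ∩ V⁻¹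
  have hV'o : IsOpen V' := hV.inter hV.inv
  have hV'1 : (1 : ℕ → Circle) ∈ V' := ⟨hV1, by simpa using hV1⟩
  -- Poincaré recurrence: some `x` in `V'` returns to `V'` after arbitrarily many steps `m`, and
  -- `primeFlow 1 ^ m = (primeFlow 1 ^ m * x) * x⁻¹` is then near 1.
  have hcons : Conservative (primeFlow 1 * ·) torusHaar :=
    (measurePreserving_mul_left torusHaar (primeFlow 1)).conservative
  obtain ⟨m, hm, hm0⟩ := hcons.exists_gt_measure_inter_ne_zero
    hV'o.measurableSet.nullMeasurableSet (hV'o.measure_pos torusHaar ⟨1, hV'1⟩).ne' ⌈T - t₀⌉₊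
  obtain ⟨x, hx, hx2⟩ := nonempty_of_measure_ne_zero hm0
  refine ⟨m + t₀, ?_, ?_⟩
  · have := Nat.le_ceil (T - t₀)
    have h2 : ((⌈T - t₀⌉₊ : ℕ) : ℝ) < m := by exact_mod_cast hm
    linarith
  · rw [primeFlow_add, primeFlow_nat]
    have hx3 : primeFlow 1 ^ m * x ∈ V' := by simpa [mul_left_iterate] using hx2
    have := hVV _ hx3.1 _ hx.2
    simpa using this

end Kronecker

/-! ### Weak convergence through Fourier coefficients -/

section WeakConvergence

theorem continuous_integral_torusCharacter (q : ℕ+ × ℕ+) :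
    Continuous fun μ : ProbabilityMeasure (ℕ → Circle) => ∫ z, torusCharacter q z ∂μ := by
  rw [continuous_iff_continuousAt]
  intro μ
  exact (ProbabilityMeasure.tendsto_iff_forall_integral_rclike_tendsto ℂ).1 tendsto_id
    (torusCharacterBCF q)

/-- Lévy's continuity theorem on the polytorus. -/
theorem tendsto_probabilityMeasure_of_tendsto_integral_torusCharacter {ι : Type*} {l : Filter ι}
    {μs : ι → ProbabilityMeasure (ℕ → Circle)} {μ : ProbabilityMeasure (ℕ → Circle)}
    (h : ∀ q, Tendsto (fun i => ∫ z, torusCharacter q z ∂(μs i)) l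
      (𝓝 (∫ z, torusCharacter q z ∂μ))) : Tendsto μs l (𝓝 μ) := by
  -- Probability measures on a compact metrizable space form a compact space, so it suffices to
  -- identify the cluster points.
  refine tendsto_nhds_of_unique_mapClusterPt fun ρ hρ => ?_
  obtain ⟨U, hU, hUρ⟩ := mapClusterPt_iff_ultrafilter.1 hρ
  refine Subtype.ext (ext_of_integral_torusCharacter_eq (μ := (ρ : Measure (ℕ → Circle)))
    (ν := (μ : Measure (ℕ → Circle))) fun q => ?_)
  exact tendsto_nhds_unique (((continuous_integral_torusCharacter q).tendsto ρ).comp hUρ)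
    ((h q).mono_left hU)

/-- Prescribed limits of Fourier coefficients are the Fourier coefficients of a measure. -/
theorem exists_probabilityMeasure_integral_torusCharacter_eq {ι : Type*} {l : Filter ι} [l.NeBot]
    {μs : ι → ProbabilityMeasure (ℕ → Circle)} {c : ℕ+ × ℕ+ → ℂ}
    (h : ∀ q, Tendsto (fun i => ∫ z, torusCharacter q z ∂(μs i)) l (𝓝 (c q))) :
    ∃ μ : ProbabilityMeasure (ℕ → Circle), ∀ q, ∫ z, torusCharacter q z ∂μ = c q := by
  obtain ⟨ρ, hρ⟩ := exists_clusterPt_of_compactSpace (map μs l)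
  obtain ⟨U, hU, hUρ⟩ := mapClusterPt_iff_ultrafilter.1 hρ
  exact ⟨ρ, fun q => tendsto_nhds_unique
    (((continuous_integral_torusCharacter q).tendsto ρ).comp hUρ) ((h q).mono_left hU)⟩

open Classical in
/-- The law of `primeFlow t` for `t` distributed in `[0, T]` according to `ν`
(with a junk value if `[0, T]` has measure zero). -/
noncomputable def primeFlowLaw (ν : Measure ℝ) [IsLocallyFiniteMeasure ν] (T : ℝ) :
    ProbabilityMeasure (ℕ → Circle) :=
  if h : 0 < ν (Set.Icc 0 T) then
    ⟨(ProbabilityTheory.cond ν (Set.Icc 0 T)).map primeFlow,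
      have := ProbabilityTheory.cond_isProbabilityMeasure_of_finite h.ne'
        isCompact_Icc.measure_lt_top.ne
      Measure.isProbabilityMeasure_map continuous_primeFlow.aemeasurable⟩
  else ⟨Measure.dirac 1, inferInstance⟩

variable {ν : Measure ℝ} [IsLocallyFiniteMeasure ν]

theorem integral_primeFlowLaw {E : Type*} [NormedAddCommGroup E] [NormedSpace ℝ E]
    [SecondCountableTopology E] {T : ℝ}
    (hT : 0 < ν (Set.Icc 0 T)) {G : (ℕ → Circle) → E} (hG : Continuous G) :
    ∫ z, G z ∂(primeFlowLaw ν T)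
      = (1 / ν.real (Set.Icc 0 T)) • ∫ t in Set.Icc 0 T, G (primeFlow t) ∂ν := by
  have h : (primeFlowLaw ν T : Measure (ℕ → Circle))
      = (ProbabilityTheory.cond ν (Set.Icc 0 T)).map primeFlow :=
    congrArg Subtype.val (dif_pos hT)
  rw [h, integral_map continuous_primeFlow.aemeasurable hG.aestronglyMeasurable,
    ProbabilityTheory.cond, integral_smul_measure, one_div, measureReal_def, ENNReal.toReal_inv]

end WeakConvergence

/-! ### Realizing a given measure as a limit law -/

section Sampling

open ProbabilityTheory in
theorem ae_tendsto_average_comp {E Ω : Type*} [MeasurableSpace E] [MeasurableSpace Ω]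
    {P : Measure Ω} {μ : Measure E} {f : E → ℂ} (hf : Measurable f) (hfi : Integrable f μ)
    {X : ℕ → Ω → E} (hX : ∀ i, MeasurePreserving (X i) P μ)
    (hindep : Pairwise fun i j => IndepFun (fun ω => f (X i ω)) (fun ω => f (X j ω)) P) :
    ∀ᵐ ω ∂P, Tendsto (fun n : ℕ => (n : ℝ)⁻¹ •
      ∑ k ∈ Finset.range n, f (X k ω)) atTop (𝓝 (∫ x, f x ∂μ)) := by
  have hmap (i : ℕ) : P.map (fun ω => f (X i ω)) = μ.map f := by
    rw [← (hX i).map_eq, Measure.map_map hf (hX i).measurable]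
    rfl
  have hm (i : ℕ) : Measurable fun ω => f (X i ω) := hf.comp (hX i).measurable
  have h0 : ∫ ω, f (X 0 ω) ∂P = ∫ x, f x ∂μ := by
    rw [← (hX 0).map_eq, integral_map (hX 0).measurable.aemeasurable hf.aestronglyMeasurable]
  rw [← h0]
  exact strong_law_ae (fun k ω => f (X k ω)) ((hX 0).integrable_comp_of_integrable hfi) hindep
    fun i => ⟨(hm i).aemeasurable, (hm 0).aemeasurable, by rw [hmap, hmap]⟩

open ProbabilityTheory in
theorem ae_tendsto_average_infinitePi {E : Type*} [MeasurableSpace E] (μ : Measure E)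
    [IsProbabilityMeasure μ] {f : E → ℂ} (hf : Measurable f) (hfi : Integrable f μ) :
    ∀ᵐ ω ∂(Measure.infinitePi fun _ : ℕ => μ), Tendsto (fun n : ℕ => (n : ℝ)⁻¹ •
      ∑ k ∈ Finset.range n, f (ω k)) atTop (𝓝 (∫ x, f x ∂μ)) := by
  have heval (i : ℕ) : MeasurePreserving (fun ω : ℕ → E => ω i)
      (Measure.infinitePi fun _ : ℕ => μ) μ :=
    ⟨measurable_pi_apply i, Measure.infinitePi_map_eval (fun _ => μ) i⟩
  exact ae_tendsto_average_comp hf hfi heval fun _ _ hij =>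
    (iIndepFun_infinitePi (P := fun _ : ℕ => μ) (X := fun _ => f) fun _ => hf).indepFun hij

/-- Every probability measure on the polytorus has an equidistributed sequence. -/
theorem exists_seq_tendsto_average_torusCharacter (μ : Measure (ℕ → Circle))
    [IsProbabilityMeasure μ] :
    ∃ z : ℕ → ℕ → Circle, ∀ q, Tendsto (fun n : ℕ => (n : ℝ)⁻¹ •
      ∑ k ∈ Finset.range n, torusCharacter q (z k)) atTop (𝓝 (∫ z, torusCharacter q z ∂μ)) :=
  -- There are countably many characters, so almost every i.i.d. sample serves them all.
  (ae_all_iff.2 fun q => ae_tendsto_average_infinitePi μ (continuous_torusCharacter q).measurable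
    (integrable_torusCharacter q μ)).exists

/-- A sequence of points of the polytorus is shadowed by a sparse sequence on the prime flow. -/
theorem exists_seq_primeFlow_shadow (z : ℕ → ℕ → Circle) :
    ∃ t : ℕ → ℝ, 0 ≤ t 0 ∧ (∀ k, t k + 1 ≤ t (k + 1)) ∧
      ∀ q, Tendsto (fun k => torusCharacter q (primeFlow (t k)) - torusCharacter q (z k))
        atTop (𝓝 0) := by
  -- At stage `k` only the finitely many characters with both indices at most `k` are controlled;
  -- each fixed character is controlled from some stage on.
  have step (k : ℕ) (T : ℝ) : ∃ t ≥ T, ∀ q : ℕ+ × ℕ+, (q.1 : ℕ) ≤ k → (q.2 : ℕ) ≤ k →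
      ‖torusCharacter q (primeFlow t) - torusCharacter q (z k)‖ < 1 / ((k : ℝ) + 1) := by
    let S : Set (ℕ+ × ℕ+) := {q | (q.1 : ℕ) ≤ k ∧ (q.2 : ℕ) ≤ k}
    have hS : S.Finite := by
      refine Set.Finite.of_injOn (f := fun q : ℕ+ × ℕ+ => ((q.1 : ℕ), (q.2 : ℕ)))
        (t := (Finset.Iic k ×ˢ Finset.Iic k : Finset (ℕ × ℕ))) ?_ ?_ (Finset.finite_toSet _)
      · intro q hq
        simpa [S] using hq
      · rintro ⟨a, b⟩ - ⟨c, d⟩ - h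
        simpa using h
    let U : Set (ℕ → Circle) := ⋂ q ∈ S,
      {g | ‖torusCharacter q g - torusCharacter q (z k)‖ < 1 / ((k : ℝ) + 1)}
    have hU : IsOpen U := hS.isOpen_biInter fun q _ =>
      isOpen_lt ((continuous_torusCharacter q).sub continuous_const).norm continuous_const
    have hz : z k ∈ U := by
      simp only [U, Set.mem_iInter, Set.mem_ofPred_eq, sub_self, norm_zero]
      intros
      positivity
    obtain ⟨t, ht, htU⟩ := exists_primeFlow_mem hU ⟨_, hz⟩ T
    exact ⟨t, ht, fun q h1 h2 => Set.mem_iInter₂.1 htU q ⟨h1, h2⟩⟩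
  choose τ hτ hτz using step
  let t : ℕ → ℝ := fun k => Nat.rec (τ 0 0) (fun k s => τ (k + 1) (s + 1)) k
  have ht (k : ℕ) : ∃ T, t k = τ k T := by
    cases k with
    | zero => exact ⟨0, rfl⟩
    | succ k => exact ⟨t k + 1, rfl⟩
  refine ⟨t, hτ 0 0, fun k => hτ (k + 1) (t k + 1), fun q => ?_⟩
  refine squeeze_zero_norm' ?_ tendsto_one_div_add_atTop_nhds_zero_nat
  filter_upwards [eventually_ge_atTop (q.1 : ℕ), eventually_ge_atTop (q.2 : ℕ)] with k h1 h2
  obtain ⟨T, hT⟩ := ht k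
  rw [hT]
  exact (hτz k T q h1 h2).le

/-- The counting measure of a sparse sequence `t`: its restriction to `[0, T]` is the counting
measure of an initial segment. -/
theorem sum_dirac_restrict_Icc {t : ℕ → ℝ} (h0 : 0 ≤ t 0) (ht : ∀ k, t k + 1 ≤ t (k + 1)) :
    ∃ K : ℝ → ℕ, Tendsto K atTop atTop ∧ ∀ T,
      (Measure.sum fun k => Measure.dirac (t k)).restrict (Set.Icc 0 T)
        = ∑ k ∈ Finset.range (K T), Measure.dirac (t k) := by
  have hmono : StrictMono t := strictMono_nat_of_lt_succ fun k => by linarith [ht k]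
  have hge (k : ℕ) : (k : ℝ) ≤ t k := by
    induction k with
    | zero => simpa using h0
    | succ k ih => push_cast; linarith [ht k]
  have hex (T : ℝ) : ∃ k, T < t k :=
    ⟨⌊T⌋₊ + 1, (Nat.lt_floor_add_one T).trans_le (by exact_mod_cast hge _)⟩
  classical
  -- As `t` increases, the first index with `t k > T` counts the points in `[0, T]`.
  refine ⟨fun T => Nat.find (hex T), tendsto_atTop.2 fun j => ?_, fun T => ?_⟩
  · filter_upwards [eventually_ge_atTop (t j)] with T hT
    rw [Nat.le_find_iff]
    intro m hm
    exact not_lt.2 ((hmono hm).le.trans hT)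
  · have hiff (k : ℕ) : t k ∈ Set.Icc 0 T ↔ k < Nat.find (hex T) := by
      rw [Nat.lt_find_iff]
      refine ⟨fun h m hm => not_lt.2 ((hmono.monotone hm).trans h.2),
        fun h => ⟨(Nat.cast_nonneg k).trans (hge k), not_lt.1 (h k le_rfl)⟩⟩
    ext s hs
    rw [Measure.restrict_apply hs, Measure.sum_apply _ (hs.inter measurableSet_Icc),
      Measure.coe_finsetSum, Finset.sum_apply,
      tsum_eq_sum (s := Finset.range (Nat.find (hex T)))]
    · refine Finset.sum_congr rfl fun k hk => ?_
      have := (hiff k).2 (Finset.mem_range.1 hk)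
      rw [Measure.dirac_apply' _ (hs.inter measurableSet_Icc), Measure.dirac_apply' _ hs,
        Set.inter_indicator_one, Pi.mul_apply, Set.indicator_of_mem this, Pi.one_apply, mul_one]
    · intro k hk
      have := mt (hiff k).1 (fun h => hk (Finset.mem_range.2 h))
      rw [Measure.dirac_apply' _ (hs.inter measurableSet_Icc),
        Set.indicator_of_notMem fun h => this h.2]

/-- Every probability measure on the polytorus is the limit law of the prime flow with respect
to some locally finite measure on the line. -/
theorem exists_measure_tendsto_primeFlowLaw (μ : ProbabilityMeasure (ℕ → Circle)) :
    ∃ (ν : Measure ℝ) (_ : IsLocallyFiniteMeasure ν),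
      (∀ᶠ T : ℝ in atTop, 0 < ν (Set.Icc 0 T)) ∧ Tendsto (primeFlowLaw ν) atTop (𝓝 μ) := by
  obtain ⟨z, hz⟩ := exists_seq_tendsto_average_torusCharacter (μ : Measure (ℕ → Circle))
  obtain ⟨t, h0, ht, htz⟩ := exists_seq_primeFlow_shadow z
  obtain ⟨K, hK, hKr⟩ := sum_dirac_restrict_Icc h0 ht
  set ν : Measure ℝ := Measure.sum fun k => Measure.dirac (t k) with hν
  have hνT (T : ℝ) : ν (Set.Icc 0 T) = K T := by
    rw [← Measure.restrict_apply_univ, hKr]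
    simp
  have hneg : ν (Set.Iio 0) = 0 := by
    have hmono : StrictMono t := strictMono_nat_of_lt_succ fun k => by linarith [ht k]
    rw [hν, Measure.sum_apply _ measurableSet_Iio, ENNReal.tsum_eq_zero]
    intro k
    have : 0 ≤ t k := h0.trans (hmono.monotone (Nat.zero_le k))
    simp [this]
  have hfin : IsLocallyFiniteMeasure ν := by
    refine ⟨fun x => ⟨Set.Iic (x + 1), Iic_mem_nhds (by linarith), ?_⟩⟩
    calc ν (Set.Iic (x + 1)) ≤ ν (Set.Iio 0 ∪ Set.Icc 0 (x + 1)) := by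
          refine measure_mono fun y hy => ?_
          by_cases h : y < 0
          · exact Or.inl h
          · exact Or.inr ⟨not_lt.1 h, hy⟩
      _ ≤ ν (Set.Iio 0) + ν (Set.Icc 0 (x + 1)) := measure_union_le _ _
      _ < ⊤ := by rw [hneg, hνT]; simp
  have hpos : ∀ᶠ T : ℝ in atTop, 0 < ν (Set.Icc 0 T) := by
    filter_upwards [hK.eventually_gt_atTop 0] with T hT
    rw [hνT]
    exact_mod_cast hT
  refine ⟨ν, hfin, hpos,
    tendsto_probabilityMeasure_of_tendsto_integral_torusCharacter fun q => ?_⟩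
  -- Cesàro means of a null sequence are null, so the shadowing points inherit the equidistribution
  -- of `z`.
  have h1 : Tendsto (fun n : ℕ => (n : ℝ)⁻¹ •
      ∑ k ∈ Finset.range n, torusCharacter q (primeFlow (t k))) atTop
      (𝓝 (∫ z, torusCharacter q z ∂μ)) := by
    have := (htz q).cesaro_smul.add (hz q)
    simp only [zero_add, ← smul_add, ← Finset.sum_add_distrib, sub_add_cancel] at this
    exact this
  refine (h1.comp hK).congr' ?_
  filter_upwards [hpos] with T hT
  rw [integral_primeFlowLaw hT (continuous_torusCharacter q), hKr, integral_finsetSum_measure]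
  · simp [measureReal_def, hνT]
  · intro k _
    exact integrable_dirac (by simp)

end Sampling

/-! ### Convergence, holomorphy and boundedness in the half plane -/

section HalfPlane

theorem isOpen_rightHalfPlane : IsOpen rightHalfPlane :=
  isOpen_lt continuous_const Complex.continuous_re

theorem convex_rightHalfPlane : Convex ℝ rightHalfPlane :=
  convex_halfSpace_re_gt 0

/-- Mean value inequality on `[n, n + 1]`, where the derivative of `x^(-w)` is largest at the left
end. The bound is summable in `n`. -/
theorem norm_natCast_cpow_neg_sub_le {n : ℕ} (hn : n ≠ 0) {w : ℂ} (hw : 0 < w.re) :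
    ‖(n : ℂ) ^ (-w) - ((n + 1 : ℕ) : ℂ) ^ (-w)‖ ≤ ‖w‖ * (n : ℝ) ^ (-w.re - 1) := by
  have hn0 : (0 : ℝ) < n := by exact_mod_cast Nat.pos_of_ne_zero hn
  have hw0 : w ≠ 0 := by rintro rfl; simp at hw
  have h := (convex_Icc (n : ℝ) (n + 1)).norm_image_sub_le_of_norm_hasDerivWithin_le
    (f := fun x : ℝ => (x : ℂ) ^ (-w)) (f' := fun x : ℝ => -w * (x : ℂ) ^ (-w - 1))
    (C := ‖w‖ * (n : ℝ) ^ (-w.re - 1)) (x := n + 1) (y := n)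
    (fun x hx => (hasDerivAt_ofReal_cpow_const (hn0.trans_le hx.1).ne'
      (neg_ne_zero.2 hw0)).hasDerivWithinAt)
    (fun x hx => by
      have hx0 : 0 < x := hn0.trans_le hx.1
      rw [norm_mul, norm_neg, Complex.norm_cpow_eq_rpow_re_of_pos hx0]
      gcongr
      simp only [Complex.sub_re, Complex.neg_re, Complex.one_re]
      exact Real.rpow_le_rpow_of_nonpos hn0 hx.1 (by linarith))
    (by simp) (by simp)
  simpa using h

theorem Finset.sum_Icc_mul_eq_sum_partial_sums {R : Type*} [CommRing R] (b c : ℕ → R) (N : ℕ) :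
    ∑ n ∈ Finset.Icc 1 N, b n * c n = (∑ n ∈ Finset.Icc 1 N, b n) * c (N + 1) +
      ∑ n ∈ Finset.Icc 1 N, (∑ m ∈ Finset.Icc 1 n, b m) * (c n - c (n + 1)) := by
  induction N with
  | zero => simp
  | succ N ih =>
    rw [Finset.sum_Icc_succ_top (by omega), ih, Finset.sum_Icc_succ_top (by omega),
      Finset.sum_Icc_succ_top (by omega), Finset.sum_Icc_succ_top (by omega)]
    ring

end HalfPlane

namespace IsUniformDirichletSeries

variable {a : ℕ → ℂ} {f : ℂ → ℂ}

theorem exists_bound_partialSum (h : IsUniformDirichletSeries a f) {s : ℂ}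
    (hs : s ∈ rightHalfPlane) :
    ∃ B, ∀ N, ‖∑ n ∈ Finset.Icc 1 N, a n * (n : ℂ) ^ (-s)‖ ≤ B := by
  obtain ⟨B, hB⟩ := (h.converges s hs).norm.bddAbove_range
  exact ⟨B, fun N => hB ⟨N, rfl⟩⟩

/-- Summation by parts turns a Dirichlet series into an absolutely convergent series at the
points to the right of a point of convergence. -/
theorem hasSum_by_parts (h : IsUniformDirichletSeries a f) {s z : ℂ}
    (hs : s ∈ rightHalfPlane) (hz : s.re < z.re) :
    HasSum (fun n : ℕ => (∑ m ∈ Finset.Icc 1 n, a m * (m : ℂ) ^ (-s)) *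
      ((n : ℂ) ^ (-(z - s)) - ((n + 1 : ℕ) : ℂ) ^ (-(z - s)))) (f z) := by
  obtain ⟨B, hB⟩ := h.exists_bound_partialSum hs
  have hw : 0 < (z - s).re := by simpa using hz
  have hB0 : 0 ≤ B := (norm_nonneg _).trans (hB 0)
  have hsum : Summable (fun n : ℕ => (∑ m ∈ Finset.Icc 1 n, a m * (m : ℂ) ^ (-s)) *
      ((n : ℂ) ^ (-(z - s)) - ((n + 1 : ℕ) : ℂ) ^ (-(z - s)))) := by
    refine Summable.of_norm_bounded (g := fun n : ℕ => B * (‖z - s‖ * (n : ℝ) ^ (-(z - s).re - 1)))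
      ?_ fun n => ?_
    · exact ((Real.summable_nat_rpow.2 (by linarith)).mul_left _).mul_left _
    · rcases eq_or_ne n 0 with rfl | hn
      · simp only [zero_lt_one, Finset.Icc_eq_empty_of_lt, Finset.sum_empty, zero_mul, norm_zero]
        positivity
      · rw [norm_mul]
        exact mul_le_mul (hB n) (norm_natCast_cpow_neg_sub_le hn hw) (norm_nonneg _) hB0
  -- The boundary term: bounded partial sums times a decaying power.
  have hlim : Tendsto (fun N : ℕ => (∑ m ∈ Finset.Icc 1 N, a m * (m : ℂ) ^ (-s)) *
      ((N + 1 : ℕ) : ℂ) ^ (-(z - s))) atTop (𝓝 0) := by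
    have h1 : Tendsto (fun N : ℕ => B * ((N + 1 : ℕ) : ℝ) ^ (-(z - s).re)) atTop (𝓝 0) := by
      simpa using (((tendsto_rpow_neg_atTop hw).comp tendsto_natCast_atTop_atTop).comp
        (tendsto_add_atTop_nat 1)).const_mul B
    refine squeeze_zero_norm (fun N => ?_) h1
    rw [norm_mul, Complex.norm_natCast_cpow_of_pos (Nat.succ_pos N)]
    exact mul_le_mul_of_nonneg_right (hB N) (by positivity)
  have hz0 : z ∈ rightHalfPlane := lt_trans hs hz
  have hf := (h.converges z hz0).sub hlim
  rw [sub_zero] at hf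
  have heq (N : ℕ) : ∑ n ∈ Finset.Icc 1 N, a n * (n : ℂ) ^ (-z)
      - (∑ m ∈ Finset.Icc 1 N, a m * (m : ℂ) ^ (-s)) * ((N + 1 : ℕ) : ℂ) ^ (-(z - s))
      = ∑ n ∈ Finset.range (N + 1), (∑ m ∈ Finset.Icc 1 n, a m * (m : ℂ) ^ (-s)) *
      ((n : ℂ) ^ (-(z - s)) - ((n + 1 : ℕ) : ℂ) ^ (-(z - s))) := by
    have h1 : ∑ n ∈ Finset.Icc 1 N, a n * (n : ℂ) ^ (-z)
        = ∑ n ∈ Finset.Icc 1 N, (a n * (n : ℂ) ^ (-s)) * (n : ℂ) ^ (-(z - s)) := by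
      refine Finset.sum_congr rfl fun n hn => ?_
      have hn0 : (n : ℂ) ≠ 0 := by
        have := (Finset.mem_Icc.1 hn).1
        exact_mod_cast (by omega : n ≠ 0)
      rw [mul_assoc, ← Complex.cpow_add _ _ hn0]
      congr 2
      ring
    rw [h1, Finset.sum_Icc_mul_eq_sum_partial_sums _ (fun n : ℕ => (n : ℂ) ^ (-(z - s))),
      add_sub_cancel_left, Finset.range_eq_Ico, Finset.sum_eq_sum_Ico_succ_bot (Nat.succ_pos N)]
    simp only [zero_lt_one, Finset.Icc_eq_empty_of_lt, Finset.sum_empty, zero_mul, zero_add]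
    rfl
  have h2 := (hsum.hasSum.tendsto_sum_nat.comp (tendsto_add_atTop_nat 1))
  have h3 := tendsto_nhds_unique (hf.congr heq) h2
  rw [h3]
  exact hsum.hasSum

/-- Summed by parts from `s = Re z₀ / 3`, the series is dominated uniformly near `z₀`, since there
`Re (z - s) > Re z₀ / 3`; Weierstrass' theorem applies. -/
theorem differentiableOn (h : IsUniformDirichletSeries a f) :
    DifferentiableOn ℂ f rightHalfPlane := by
  intro z₀ hz₀
  have hz₀' : 0 < z₀.re := hz₀
  let s : ℂ := ((z₀.re / 3 : ℝ) : ℂ)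
  have hs : s ∈ rightHalfPlane := by
    change 0 < s.re
    simp only [s, Complex.ofReal_re]
    linarith
  obtain ⟨B, hB⟩ := h.exists_bound_partialSum hs
  have hB0 : 0 ≤ B := (norm_nonneg _).trans (hB 0)
  let U : Set ℂ := {z | 2 * z₀.re / 3 < z.re} ∩ Metric.ball s (‖z₀ - s‖ + 1)
  have hU : IsOpen U := (isOpen_lt continuous_const Complex.continuous_re).inter Metric.isOpen_ball
  have hzU : z₀ ∈ U := ⟨by change 2 * z₀.re / 3 < z₀.re; linarith, by simp [dist_eq_norm]⟩
  have key : DifferentiableOn ℂ (fun z => ∑' n : ℕ,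
      (∑ m ∈ Finset.Icc 1 n, a m * (m : ℂ) ^ (-s)) *
      ((n : ℂ) ^ (-(z - s)) - ((n + 1 : ℕ) : ℂ) ^ (-(z - s)))) U := by
    refine Complex.differentiableOn_tsum_of_summable_norm
      (u := fun n : ℕ => B * ((‖z₀ - s‖ + 1) * (n : ℝ) ^ (-(z₀.re / 3) - 1))) ?_ ?_ hU ?_
    · exact ((Real.summable_nat_rpow.2 (by linarith)).mul_left _).mul_left _
    · intro n
      rcases eq_or_ne n 0 with rfl | hn
      · simp
      · have h1 : (n : ℂ) ≠ 0 := by exact_mod_cast hn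
        have h2 : ((n + 1 : ℕ) : ℂ) ≠ 0 := by exact_mod_cast n.succ_ne_zero
        refine DifferentiableOn.const_mul (DifferentiableOn.sub ?_ ?_) _
        · exact DifferentiableOn.const_cpow (by fun_prop) (Or.inl h1)
        · exact DifferentiableOn.const_cpow (by fun_prop) (Or.inl h2)
    · intro n z hz
      rcases eq_or_ne n 0 with rfl | hn
      · simp only [zero_lt_one, Finset.Icc_eq_empty_of_lt, Finset.sum_empty, zero_mul, norm_zero]
        positivity
      · have hz1 : 2 * z₀.re / 3 < z.re := hz.1
        have hre : z₀.re / 3 < (z - s).re := by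
          simp only [s, Complex.sub_re, Complex.ofReal_re]
          linarith
        have hn1 : (1 : ℝ) ≤ n := by exact_mod_cast Nat.one_le_iff_ne_zero.2 hn
        rw [norm_mul]
        refine mul_le_mul (hB n) ((norm_natCast_cpow_neg_sub_le hn (by linarith)).trans ?_)
          (norm_nonneg _) hB0
        gcongr
        · exact (mem_ball_iff_norm.1 hz.2).le
  have heq : ∀ z ∈ U, f z = ∑' n : ℕ, (∑ m ∈ Finset.Icc 1 n, a m * (m : ℂ) ^ (-s)) *
      ((n : ℂ) ^ (-(z - s)) - ((n + 1 : ℕ) : ℂ) ^ (-(z - s))) := by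
    intro z hz
    have hz1 : 2 * z₀.re / 3 < z.re := hz.1
    refine (h.hasSum_by_parts hs ?_).tsum_eq.symm
    simp only [s, Complex.ofReal_re]
    linarith
  exact ((key.congr heq).differentiableAt (hU.mem_nhds hzU)).differentiableWithinAt

/-- Each term at `s = 1/2` is a difference of two bounded partial sums. Absolute convergence on `Re
s ≥ 2` follows, as `1/2 - 2 < -1`. -/
theorem exists_norm_coeff_le (h : IsUniformDirichletSeries a f) :
    ∃ C, ∀ n : ℕ, n ≠ 0 → ‖a n‖ ≤ C * (n : ℝ) ^ (1 / 2 : ℝ) := by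
  obtain ⟨B, hB⟩ := h.exists_bound_partialSum (s := (1 / 2 : ℝ))
    (by simp [rightHalfPlane])
  refine ⟨B + B, fun n hn => ?_⟩
  obtain ⟨m, rfl⟩ := Nat.exists_eq_succ_of_ne_zero hn
  have h1 := norm_sub_le_of_le (hB (m + 1)) (hB m)
  rw [Finset.sum_Icc_succ_top (by omega), add_sub_cancel_left, norm_mul,
    Complex.norm_natCast_cpow_of_pos (Nat.succ_pos m), Complex.neg_re, Complex.ofReal_re,
    Real.rpow_neg (Nat.cast_nonneg _), ← div_eq_mul_inv, div_le_iff₀ (by positivity)] at h1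
  exact h1

theorem exists_summable_bound (h : IsUniformDirichletSeries a f) :
    ∃ u : ℕ → ℝ, Summable u ∧ ∀ s : ℂ, 2 ≤ s.re →
      ∀ k : ℕ, ‖a (k + 1) * ((k + 1 : ℕ) : ℂ) ^ (-s)‖ ≤ u k := by
  obtain ⟨C, hC⟩ := h.exists_norm_coeff_le
  refine ⟨fun k => C * ((k + 1 : ℕ) : ℝ) ^ (-(3 / 2) : ℝ), ?_, fun s hs k => ?_⟩
  · exact ((summable_nat_add_iff 1).2 (Real.summable_nat_rpow.2 (by norm_num))).mul_left C
  · rw [norm_mul, Complex.norm_natCast_cpow_of_pos (Nat.succ_pos k)]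
    have hk : (1 : ℝ) ≤ ((k + 1 : ℕ) : ℝ) := by simp
    calc ‖a (k + 1)‖ * ((k + 1 : ℕ) : ℝ) ^ (-s).re
        ≤ (C * ((k + 1 : ℕ) : ℝ) ^ (1 / 2 : ℝ)) * ((k + 1 : ℕ) : ℝ) ^ (-2 : ℝ) := by
          refine mul_le_mul (hC _ k.succ_ne_zero) ?_ (by positivity)
            ((norm_nonneg _).trans (hC _ k.succ_ne_zero))
          exact Real.rpow_le_rpow_of_exponent_le hk (by simpa using hs)
      _ = C * ((k + 1 : ℕ) : ℝ) ^ (-(3 / 2) : ℝ) := by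
          rw [mul_assoc, ← Real.rpow_add (by positivity)]
          norm_num

theorem hasSum (h : IsUniformDirichletSeries a f) {s : ℂ} (hs : 2 ≤ s.re) :
    HasSum (fun k : ℕ => a (k + 1) * ((k + 1 : ℕ) : ℂ) ^ (-s)) (f s) := by
  obtain ⟨u, hu, hb⟩ := h.exists_summable_bound
  have hsum : Summable (fun k : ℕ => a (k + 1) * ((k + 1 : ℕ) : ℂ) ^ (-s)) :=
    Summable.of_norm_bounded hu (hb s hs)
  have hs0 : s ∈ rightHalfPlane := by change 0 < s.re; linarith
  have h1 : Tendsto (fun N : ℕ => ∑ k ∈ Finset.range N, a (k + 1) * ((k + 1 : ℕ) : ℂ) ^ (-s))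
      atTop (𝓝 (f s)) := by
    refine (h.converges s hs0).congr fun N => ?_
    rw [Finset.range_eq_Ico, Finset.sum_Ico_add' (fun k : ℕ => a k * (k : ℂ) ^ (-s))]
    rfl
  rw [tendsto_nhds_unique h1 hsum.hasSum.tendsto_sum_nat]
  exact hsum.hasSum

/-- By uniform continuity a shift to the right by `δ/2` changes `f` by at most 1, and a fixed number
of shifts leads to `Re s ≥ 2`, where absolute convergence bounds `f`. -/
theorem exists_norm_le (h : IsUniformDirichletSeries a f) :
    ∃ M, ∀ s ∈ rightHalfPlane, ‖f s‖ ≤ M := by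
  obtain ⟨u, hu, hb⟩ := h.exists_summable_bound
  obtain ⟨δ, hδ, hδf⟩ := Metric.uniformContinuousOn_iff.1 h.uniformContinuousOn 1 one_pos
  have hmem {s : ℂ} (hs : s ∈ rightHalfPlane) (x : ℝ) (hx : 0 ≤ x) :
      s + (x : ℂ) ∈ rightHalfPlane := by
    have : 0 < s.re := hs
    change 0 < (s + (x : ℂ)).re
    simp only [Complex.add_re, Complex.ofReal_re]
    linarith
  have step (k : ℕ) : ∀ s ∈ rightHalfPlane, ‖f s‖ ≤ ‖f (s + ((k * (δ / 2) : ℝ) : ℂ))‖ + k := by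
    induction k with
    | zero => simp
    | succ k ih =>
      intro s hs
      refine (ih s hs).trans ?_
      have h1 := hδf _ (hmem hs (k * (δ / 2)) (by positivity)) _
        (hmem hs ((k + 1 : ℕ) * (δ / 2)) (by positivity)) (by
          rw [dist_add_left, dist_eq_norm, ← Complex.ofReal_sub, Complex.norm_real, Real.norm_eq_abs]
          push_cast
          rw [show (k : ℝ) * (δ / 2) - (k + 1) * (δ / 2) = -(δ / 2) by ring, abs_neg,
            abs_of_pos (by positivity)]
          linarith)
      rw [dist_eq_norm] at h1
      have h2 := norm_le_norm_add_norm_sub' (f (s + ((k * (δ / 2) : ℝ) : ℂ)))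
        (f (s + (((k + 1 : ℕ) * (δ / 2) : ℝ) : ℂ)))
      push_cast at h1 h2 ⊢
      linarith
  obtain ⟨k, hk⟩ := exists_nat_gt (2 / (δ / 2))
  refine ⟨∑' k, u k + k, fun s hs => (step k s hs).trans ?_⟩
  have hs0 : 0 < s.re := hs
  have h2 : 2 ≤ (s + ((k * (δ / 2) : ℝ) : ℂ)).re := by
    simp only [Complex.add_re, Complex.ofReal_re]
    rw [div_lt_iff₀ (by positivity)] at hk
    linarith
  have := tsum_of_norm_bounded hu.hasSum (hb _ h2)
  rw [(h.hasSum h2).tsum_eq] at this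
  linarith

end IsUniformDirichletSeries

/-! ### Uniform approximation by Dirichlet polynomials -/

section Smoothing

open scoped SchwartzMap FourierTransform ContDiff in
/-- A Schwartz function whose Fourier transform is a bump function. -/
theorem exists_schwartzMap_fourier_bump : ∃ (K : 𝓢(ℝ, ℂ)) (φ : ℝ → ℂ),
    (∀ ξ : ℝ, ∫ v : ℝ, Complex.exp ((-2 * Real.pi * v * ξ : ℝ) * Complex.I) * K v = φ ξ) ∧
    (∀ ξ : ℝ, |ξ| ≤ 1 → φ ξ = 1) ∧ ∀ ξ : ℝ, 2 ≤ |ξ| → φ ξ = 0 := by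
  let b : ContDiffBump (0 : ℝ) := ⟨1, 2, one_pos, one_lt_two⟩
  have hb : HasCompactSupport fun ξ : ℝ => ((b ξ : ℝ) : ℂ) :=
    b.hasCompactSupport.comp_left Complex.ofReal_zero
  have hb2 : ContDiff ℝ ∞ fun ξ : ℝ => ((b ξ : ℝ) : ℂ) :=
    Complex.ofRealCLM.contDiff.comp b.contDiff
  let Φ : 𝓢(ℝ, ℂ) := hb.toSchwartzMap hb2
  refine ⟨𝓕⁻ Φ, fun ξ => ((b ξ : ℝ) : ℂ), fun ξ => ?_, fun ξ hξ => ?_, fun ξ hξ => ?_⟩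
  · have h1 : 𝓕 (𝓕⁻ Φ) ξ = Φ ξ := by rw [FourierTransform.fourier_fourierInv_eq]
    rw [SchwartzMap.fourier_coe, Real.fourier_real_eq_integral_exp_smul] at h1
    exact h1
  · have : b ξ = 1 := b.one_of_mem_closedBall (by simpa using hξ)
    simp [this]
  · have : b ξ = 0 := b.zero_of_le_dist (by simpa using hξ)
    simp [this]

variable {a : ℕ → ℂ} {f : ℂ → ℂ}

theorem add_mul_I_mem_rightHalfPlane {s : ℂ} (hs : s ∈ rightHalfPlane) (x : ℝ) :
    s + x * Complex.I ∈ rightHalfPlane := by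
  have : 0 < s.re := hs
  simpa [rightHalfPlane] using this

/-- The mean of `f` over a vertical line through `s`, weighted by a rescaled kernel `K`. -/
noncomputable def verticalMean (K : ℝ → ℂ) (f : ℂ → ℂ) (ρ : ℝ) (s : ℂ) : ℂ :=
  ∫ u : ℝ, f (s + (ρ * u : ℝ) * Complex.I) * K u

namespace IsUniformDirichletSeries

theorem continuous_vertical (h : IsUniformDirichletSeries a f) {s : ℂ} (hs : s ∈ rightHalfPlane)
    (ρ : ℝ) : Continuous fun u : ℝ => f (s + (ρ * u : ℝ) * Complex.I) :=
  h.uniformContinuousOn.continuousOn.comp_continuous (by fun_prop)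
    fun u => add_mul_I_mem_rightHalfPlane hs _

theorem integrable_vertical_mul (h : IsUniformDirichletSeries a f) {K : ℝ → ℂ} (hK : Integrable K)
    {s : ℂ} (hs : s ∈ rightHalfPlane) (ρ : ℝ) :
    Integrable fun u : ℝ => f (s + (ρ * u : ℝ) * Complex.I) * K u := by
  obtain ⟨M, hM⟩ := h.exists_norm_le
  exact hK.bdd_mul (c := M) (h.continuous_vertical hs ρ).aestronglyMeasurable
    (.of_forall fun u => hM _ (add_mul_I_mem_rightHalfPlane hs _))

theorem differentiableOn_verticalMean (h : IsUniformDirichletSeries a f) {K : ℝ → ℂ}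
    (hK : Integrable K) (ρ : ℝ) : DifferentiableOn ℂ (verticalMean K f ρ) rightHalfPlane := by
  intro s hs
  have hs0 : 0 < s.re := hs
  obtain ⟨M, hM⟩ := h.exists_norm_le
  have hball : ∀ z ∈ Metric.ball s (s.re / 2), s.re / 2 < z.re := by
    intro z hz
    have h1 := (Complex.abs_re_le_norm (z - s)).trans_lt (mem_ball_iff_norm.1 hz)
    rw [Complex.sub_re] at h1
    linarith [(abs_lt.1 h1).1]
  have hmem : ∀ z ∈ Metric.ball s (s.re / 2), z ∈ rightHalfPlane := fun z hz =>
    (half_pos hs0).trans (hball z hz)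
  -- Cauchy's estimate on a disc of radius `Re s / 4`, which stays in the half plane; it dominates
  -- the derivative under the integral.
  have hderiv {z : ℂ} (hz : s.re / 2 < z.re) : ‖deriv f z‖ ≤ M / (s.re / 4) := by
    have hsub : Metric.closedBall z (s.re / 4) ⊆ rightHalfPlane := by
      intro y hy
      have h1 := (Complex.abs_re_le_norm (y - z)).trans (mem_closedBall_iff_norm.1 hy)
      rw [Complex.sub_re] at h1
      change 0 < y.re
      linarith [(abs_le.1 h1).1]
    exact Complex.norm_deriv_le_of_forall_mem_sphere_norm_le (by positivity)
      (h.differentiableOn.diffContOnCl_ball hsub)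
      fun y hy => hM y (hsub (Metric.sphere_subset_closedBall hy))
  refine (hasDerivAt_integral_of_dominated_loc_of_deriv_le
    (F := fun (z : ℂ) (u : ℝ) => f (z + (ρ * u : ℝ) * Complex.I) * K u)
    (F' := fun (z : ℂ) (u : ℝ) => deriv f (z + (ρ * u : ℝ) * Complex.I) * K u)
    (bound := fun u => M / (s.re / 4) * ‖K u‖)
    (Metric.ball_mem_nhds s (half_pos hs0)) ?_ ?_ ?_ ?_ ?_ ?_).2.differentiableAt.differentiableWithinAt
  · filter_upwards [isOpen_rightHalfPlane.mem_nhds hs] with z hz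
    exact (h.integrable_vertical_mul hK hz ρ).aestronglyMeasurable
  · exact h.integrable_vertical_mul hK hs ρ
  · exact ((measurable_deriv f).comp (by fun_prop)).aestronglyMeasurable.mul
      hK.aestronglyMeasurable
  · refine .of_forall fun u z hz => ?_
    rw [norm_mul]
    gcongr
    exact hderiv (by simpa using hball z hz)
  · exact hK.norm.const_mul _
  · refine .of_forall fun u z hz => ?_
    have h1 : HasDerivAt f (deriv f (z + (ρ * u : ℝ) * Complex.I)) (z + (ρ * u : ℝ) * Complex.I) :=
      (h.differentiableOn.differentiableAt (isOpen_rightHalfPlane.mem_nhds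
        (add_mul_I_mem_rightHalfPlane (hmem z hz) _))).hasDerivAt
    exact (h1.comp_add_const z _).mul_const _

/-- `n^(-iρu)` is an exponential of frequency `ρ log n / 2π` in `u`, so averaging multiplies the
`n`-th coefficient by the Fourier transform of `K` there; absolute convergence permits termwise
integration. -/
theorem hasSum_verticalMean (h : IsUniformDirichletSeries a f) {K : ℝ → ℂ} (hK : Integrable K)
    {φ : ℝ → ℂ}
    (hφ : ∀ ξ : ℝ, ∫ v : ℝ, Complex.exp ((-2 * Real.pi * v * ξ : ℝ) * Complex.I) * K v = φ ξ)
    (ρ : ℝ) {s : ℂ} (hs : 2 ≤ s.re) :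
    HasSum (fun k : ℕ => a (k + 1) * φ (ρ * Real.log (k + 1 : ℕ) / (2 * Real.pi)) *
      ((k + 1 : ℕ) : ℂ) ^ (-s)) (verticalMean K f ρ s) := by
  obtain ⟨u, hu, hb⟩ := h.exists_summable_bound
  have hs' (v : ℝ) : 2 ≤ (s + (ρ * v : ℝ) * Complex.I).re := by simpa using hs
  have hcpow (k : ℕ) (v : ℝ) : ((k + 1 : ℕ) : ℂ) ^ (-(s + (ρ * v : ℝ) * Complex.I))
      = ((k + 1 : ℕ) : ℂ) ^ (-s) * Complex.exp
        ((-2 * Real.pi * v * (ρ * Real.log (k + 1 : ℕ) / (2 * Real.pi)) : ℝ) * Complex.I) := by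
    have hk : ((k + 1 : ℕ) : ℂ) ≠ 0 := by exact_mod_cast k.succ_ne_zero
    rw [neg_add, Complex.cpow_add _ _ hk, Complex.cpow_def_of_ne_zero hk (-(_ * _)),
      ← Complex.natCast_log]
    congr 2
    have : -2 * Real.pi * v * (ρ * Real.log (k + 1 : ℕ) / (2 * Real.pi))
        = -(ρ * v * Real.log (k + 1 : ℕ)) := by
      field_simp
    rw [this]
    push_cast
    ring
  have hFint (k : ℕ) : Integrable fun v : ℝ =>
      a (k + 1) * ((k + 1 : ℕ) : ℂ) ^ (-(s + (ρ * v : ℝ) * Complex.I)) * K v := by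
    refine hK.bdd_mul (c := u k) ?_ (.of_forall fun v => hb _ (hs' v) k)
    simp_rw [hcpow]
    exact Continuous.aestronglyMeasurable (by fun_prop)
  have hnorm : Summable fun k : ℕ => ∫ v : ℝ,
      ‖a (k + 1) * ((k + 1 : ℕ) : ℂ) ^ (-(s + (ρ * v : ℝ) * Complex.I)) * K v‖ := by
    refine Summable.of_nonneg_of_le (fun k => integral_nonneg fun v => norm_nonneg _)
      (fun k => ?_) (hu.mul_right (∫ v, ‖K v‖))
    rw [← integral_const_mul]
    refine integral_mono (hFint k).norm (hK.norm.const_mul _) fun v => ?_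
    simp only [norm_mul _ (K v)]
    gcongr
    exact hb _ (hs' v) k
  have hterm (k : ℕ) : a (k + 1) * φ (ρ * Real.log (k + 1 : ℕ) / (2 * Real.pi)) *
      ((k + 1 : ℕ) : ℂ) ^ (-s)
      = ∫ v : ℝ, a (k + 1) * ((k + 1 : ℕ) : ℂ) ^ (-(s + (ρ * v : ℝ) * Complex.I)) * K v := by
    simp_rw [hcpow]
    rw [← hφ, ← integral_const_mul, ← integral_mul_const]
    refine integral_congr_ae (.of_forall fun v => ?_)
    ring
  have hmean : verticalMean K f ρ s = ∫ v : ℝ,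
      ∑' k : ℕ, a (k + 1) * ((k + 1 : ℕ) : ℂ) ^ (-(s + (ρ * v : ℝ) * Complex.I)) * K v := by
    refine integral_congr_ae (.of_forall fun v => ?_)
    simp only [tsum_mul_right]
    rw [(h.hasSum (hs' v)).tsum_eq]
  simp_rw [hterm, hmean]
  exact hasSum_integral_of_summable_integral_norm hFint hnorm

/-- The identity holds near 3 by termwise integration; both sides are holomorphic, so it persists on
the half plane. -/
theorem verticalMean_eq_sum (h : IsUniformDirichletSeries a f) {K : ℝ → ℂ} (hK : Integrable K)
    {φ : ℝ → ℂ}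
    (hφ : ∀ ξ : ℝ, ∫ v : ℝ, Complex.exp ((-2 * Real.pi * v * ξ : ℝ) * Complex.I) * K v = φ ξ)
    {ρ : ℝ} {N : ℕ} (hN : ∀ n : ℕ, N < n → φ (ρ * Real.log n / (2 * Real.pi)) = 0)
    {s : ℂ} (hs : s ∈ rightHalfPlane) :
    verticalMean K f ρ s = ∑ n ∈ Finset.Icc 1 N,
      a n * φ (ρ * Real.log n / (2 * Real.pi)) * (n : ℂ) ^ (-s) := by
  have hD : DifferentiableOn ℂ (fun s : ℂ => ∑ n ∈ Finset.Icc 1 N,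
      a n * φ (ρ * Real.log n / (2 * Real.pi)) * (n : ℂ) ^ (-s)) rightHalfPlane := by
    refine DifferentiableOn.fun_sum fun n hn => ?_
    have hn0 : (n : ℂ) ≠ 0 := by
      have := (Finset.mem_Icc.1 hn).1
      exact_mod_cast (by omega : n ≠ 0)
    exact (DifferentiableOn.const_cpow (by fun_prop) (Or.inl hn0)).const_mul _
  refine ((h.differentiableOn_verticalMean hK ρ).analyticOnNhd isOpen_rightHalfPlane)
    |>.eqOn_of_preconnected_of_eventuallyEq (hD.analyticOnNhd isOpen_rightHalfPlane)
    convex_rightHalfPlane.isPreconnected (z₀ := 3) (by simp [rightHalfPlane]) ?_ hs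
  have hopen : IsOpen {z : ℂ | 2 < z.re} := isOpen_lt continuous_const Complex.continuous_re
  filter_upwards [hopen.mem_nhds (x := (3 : ℂ)) (by norm_num)] with z hz
  have h1 := h.hasSum_verticalMean hK hφ ρ (le_of_lt hz)
  rw [← h1.tsum_eq, tsum_eq_sum (s := Finset.range N), Finset.range_eq_Ico,
    Finset.sum_Ico_add' (fun n : ℕ => a n * φ (ρ * Real.log n / (2 * Real.pi)) * (n : ℂ) ^ (-z))]
  · rfl
  · intro k hk
    rw [hN (k + 1) (by simpa [Nat.lt_succ_iff] using hk)]
    simp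

theorem tendstoUniformlyOn_verticalMean (h : IsUniformDirichletSeries a f) {K : ℝ → ℂ}
    (hK : Integrable K) (hK1 : Integrable fun u => ‖u‖ * ‖K u‖) (hK0 : ∫ u, K u = 1) :
    TendstoUniformlyOn (fun ρ => verticalMean K f ρ) f (𝓝 0) rightHalfPlane := by
  obtain ⟨M, hM⟩ := h.exists_norm_le
  rw [Metric.tendstoUniformlyOn_iff]
  intro ε hε
  set A := ∫ u, ‖K u‖ with hA
  set B := ∫ u, ‖u‖ * ‖K u‖ with hB
  have hA0 : 0 ≤ A := integral_nonneg fun u => norm_nonneg _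
  have hB0 : 0 ≤ B := integral_nonneg fun u => by positivity
  have hM0 : 0 ≤ M := (norm_nonneg _).trans (hM 1 (by simp [rightHalfPlane]))
  set η := ε / (2 * (A + 1)) with hη
  have hη0 : 0 < η := by positivity
  obtain ⟨δ, hδ, hδf⟩ := Metric.uniformContinuousOn_iff.1 h.uniformContinuousOn η hη0
  -- Uniform continuity handles small `x`, the bound `2M` large `x`. The linear term is integrable
  -- against `K`, which has a finite first moment, and contributes a factor `|ρ|`.
  have hmod (s) (hs : s ∈ rightHalfPlane) (x : ℝ) :
      ‖f (s + x * Complex.I) - f s‖ ≤ η + 2 * M / δ * |x| := by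
    by_cases hx : |x| < δ
    · have h1 := hδf _ (add_mul_I_mem_rightHalfPlane hs x) s hs (by simpa [dist_eq_norm] using hx)
      rw [dist_eq_norm] at h1
      have : 0 ≤ 2 * M / δ * |x| := by positivity
      linarith
    · have h1 := norm_sub_le_of_le (hM _ (add_mul_I_mem_rightHalfPlane hs x)) (hM s hs)
      have h2 : 2 * M ≤ 2 * M / δ * |x| := by
        rw [div_mul_eq_mul_div, le_div_iff₀ hδ]
        gcongr
        exact not_lt.1 hx
      linarith
  have hsmall : ∀ᶠ ρ : ℝ in 𝓝 0, 2 * M / δ * |ρ| * B < ε / 2 := by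
    have : Tendsto (fun ρ : ℝ => 2 * M / δ * |ρ| * B) (𝓝 0) (𝓝 (2 * M / δ * |0| * B)) :=
      Continuous.tendsto (by fun_prop) 0
    rw [abs_zero, mul_zero, zero_mul] at this
    exact this.eventually (gt_mem_nhds (half_pos hε))
  filter_upwards [hsmall] with ρ hρ s hs
  have h1 : verticalMean K f ρ s - f s
      = ∫ u, (f (s + (ρ * u : ℝ) * Complex.I) - f s) * K u := by
    simp_rw [sub_mul]
    rw [integral_sub (h.integrable_vertical_mul hK hs ρ) (hK.const_mul _), integral_const_mul, hK0,
      mul_one]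
    rfl
  rw [dist_comm, dist_eq_norm, h1]
  calc ‖∫ u, (f (s + (ρ * u : ℝ) * Complex.I) - f s) * K u‖
      ≤ ∫ u, (η * ‖K u‖ + 2 * M / δ * |ρ| * (‖u‖ * ‖K u‖)) := by
        refine norm_integral_le_of_norm_le ((hK.norm.const_mul _).add (hK1.const_mul _))
          (.of_forall fun u => ?_)
        rw [norm_mul]
        calc ‖f (s + (ρ * u : ℝ) * Complex.I) - f s‖ * ‖K u‖
            ≤ (η + 2 * M / δ * |ρ * u|) * ‖K u‖ := by gcongr; exact hmod s hs _
          _ = _ := by rw [abs_mul, Real.norm_eq_abs]; ring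
    _ = η * A + 2 * M / δ * |ρ| * B := by
        rw [integral_add (hK.norm.const_mul _) (hK1.const_mul _), integral_const_mul,
          integral_const_mul]
    _ < ε := by
        have : η * A ≤ ε / 2 := by
          rw [hη, div_mul_eq_mul_div, div_le_div_iff₀ (by positivity) two_pos]
          nlinarith
        linarith

/-- A Dirichlet series in `𝒜(ℂ₊)` is a uniform limit on `ℂ₊` of Dirichlet polynomials whose
coefficients converge to those of the series. -/
theorem exists_dirichletPolynomial_approx (h : IsUniformDirichletSeries a f) :
    ∃ (c : ℕ → ℕ → ℂ) (N : ℕ → ℕ),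
      (∀ n, n ≠ 0 → Tendsto (fun k => c k n) atTop (𝓝 (a n))) ∧
      (∀ k n, N k < n → c k n = 0) ∧
      TendstoUniformlyOn (fun k s => ∑ n ∈ Finset.Icc 1 (N k), c k n * (n : ℂ) ^ (-s)) f atTop
        rightHalfPlane := by
  obtain ⟨K, φ, hφ, hφ1, hφ0⟩ := exists_schwartzMap_fourier_bump
  have hK : Integrable K := K.integrable
  have hK1 : Integrable fun u => ‖u‖ * ‖K u‖ := by
    simpa using K.integrable_pow_mul volume 1
  have hK0 : ∫ u, K u = 1 := by
    have := hφ 0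
    rw [hφ1 0 (by simp)] at this
    simpa using this
  let ρ : ℕ → ℝ := fun k => 1 / ((k : ℝ) + 1)
  have hρ0 (k) : 0 < ρ k := by positivity
  have hρ : Tendsto ρ atTop (𝓝 0) := tendsto_one_div_add_atTop_nhds_zero_nat
  -- Beyond this index `ρ log n / 2π ≥ 2`, where `φ` vanishes.
  let N : ℕ → ℕ := fun k => ⌈Real.exp (4 * Real.pi / ρ k)⌉₊
  have hN (k n : ℕ) (hn : N k < n) : φ (ρ k * Real.log n / (2 * Real.pi)) = 0 := by
    refine hφ0 _ (le_abs.2 (Or.inl ?_))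
    have h1 : Real.exp (4 * Real.pi / ρ k) ≤ n :=
      (Nat.le_ceil _).trans (by exact_mod_cast hn.le)
    have h2 := (Real.le_log_iff_exp_le ((Real.exp_pos _).trans_le h1)).2 h1
    rw [div_le_iff₀ (hρ0 k)] at h2
    rw [le_div_iff₀ (by positivity)]
    linarith
  refine ⟨fun k n => a n * φ (ρ k * Real.log n / (2 * Real.pi)), N, fun n hn => ?_,
    fun k n hn => by simp [hN k n hn], ?_⟩
  · refine tendsto_const_nhds.congr' ?_
    have h1 : Tendsto (fun k => |ρ k * Real.log n / (2 * Real.pi)|) atTop (𝓝 0) := by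
      simpa using ((hρ.mul_const (Real.log n)).div_const (2 * Real.pi)).abs
    filter_upwards [h1.eventually (gt_mem_nhds one_pos)] with k hk
    rw [hφ1 _ hk.le, mul_one]
  · refine TendstoUniformlyOn.congr
      (fun U hU => hρ.eventually (h.tendstoUniformlyOn_verticalMean hK hK1 hK0 U hU)) ?_
    exact .of_forall fun k s hs => h.verticalMean_eq_sum hK hφ (hN k) hs

end IsUniformDirichletSeries

end Smoothing

/-! ### Bohr's inequality and the maximum principle -/

section BohrPolynomials

/-- The closed polydisk. -/
def closedPolydisk : Set (ℕ → ℂ) := {w | ∀ j, ‖w j‖ ≤ 1}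

theorem finitePolydisk_subset_closedPolydisk : finitePolydisk ⊆ closedPolydisk :=
  fun _ hw j => (hw.1 j).le

theorem circle_mem_closedPolydisk (z : ℕ → Circle) : (fun j => (z j : ℂ)) ∈ closedPolydisk :=
  fun j => (Circle.norm_coe (z j)).le

/-- Truncate to the first `k` coordinates and shrink. Limits at torus points are thereby unique. -/
theorem circle_mem_closure_finitePolydisk (z : ℕ → Circle) :
    (fun j => (z j : ℂ)) ∈ closure finitePolydisk := by
  let w : ℕ → ℕ → ℂ := fun k j => if j < k then ((1 - 1 / ((k : ℝ) + 1) : ℝ) : ℂ) * z j else 0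
  have hlim : Tendsto w atTop (𝓝 fun j => (z j : ℂ)) := by
    refine tendsto_pi_nhds.2 fun j => ?_
    have h1 : Tendsto (fun k : ℕ => ((1 - 1 / ((k : ℝ) + 1) : ℝ) : ℂ) * z j) atTop (𝓝 (z j)) := by
      have := (tendsto_one_div_add_atTop_nhds_zero_nat (𝕜 := ℝ)).const_sub 1
      simpa using ((Complex.continuous_ofReal.tendsto _).comp this).mul_const (z j : ℂ)
    refine h1.congr' ?_
    filter_upwards [eventually_gt_atTop j] with k hk
    simp [w, hk]
  refine mem_closure_of_tendsto hlim (.of_forall fun k => ⟨fun j => ?_, ?_⟩)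
  · by_cases hj : j < k
    · have h0 : (0 : ℝ) < 1 / ((k : ℝ) + 1) := by positivity
      have h1 : 1 / ((k : ℝ) + 1) ≤ 1 := by
        rw [div_le_one (by positivity)]
        linarith [(Nat.cast_nonneg k : (0 : ℝ) ≤ k)]
      simp only [w, hj, if_true, norm_mul, Complex.norm_real, Circle.norm_coe, mul_one,
        Real.norm_eq_abs]
      rw [abs_of_nonneg (by linarith)]
      linarith
    · simp [w, hj]
  · refine (Set.finite_lt_nat k).subset fun j hj => ?_
    by_contra hjk
    exact hj (if_neg hjk)

/-- The polynomial `∑ c n * z₁^α₁ z₂^α₂ ⋯`, summed over `1 ≤ n ≤ N`. -/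
noncomputable def bohrPolynomial (c : ℕ → ℂ) (N : ℕ) (w : ℕ → ℂ) : ℂ :=
  ∑ n ∈ Finset.Icc 1 N, c n * bohrMonomial n w

theorem continuous_bohrPolynomial (c : ℕ → ℂ) (N : ℕ) : Continuous (bohrPolynomial c N) :=
  continuous_finsetSum _ fun n _ => continuous_const.mul (continuous_bohrMonomial n)

theorem bohrPolynomial_eq_of_le {c : ℕ → ℂ} {N N' : ℕ} (hN : N ≤ N')
    (hc : ∀ n, N < n → c n = 0) (w : ℕ → ℂ) : bohrPolynomial c N w = bohrPolynomial c N' w := by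
  refine Finset.sum_subset (Finset.Icc_subset_Icc_right hN) fun n hn hn' => ?_
  rw [hc n, zero_mul]
  simp only [Finset.mem_Icc] at hn hn'
  omega

theorem bohrPolynomial_sub (c d : ℕ → ℂ) (N : ℕ) (w : ℕ → ℂ) :
    bohrPolynomial (c - d) N w = bohrPolynomial c N w - bohrPolynomial d N w := by
  simp [bohrPolynomial, sub_mul]

theorem bohrPolynomial_primeFlow (c : ℕ → ℂ) (N : ℕ) (t : ℝ) :
    bohrPolynomial c N (fun j => (primeFlow t j : ℂ))
      = ∑ n ∈ Finset.Icc 1 N, c n * (n : ℂ) ^ (-(t * Complex.I)) := by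
  refine Finset.sum_congr rfl fun n hn => ?_
  rw [bohrMonomial_primeFlow (by have := (Finset.mem_Icc.1 hn).1; omega)]

theorem differentiable_bohrMonomial_update (n : ℕ) (w : ℕ → ℂ) (j : ℕ) :
    Differentiable ℂ fun u => bohrMonomial n (Function.update w j u) := by
  unfold bohrMonomial Finsupp.prod
  refine Differentiable.fun_finsetProd fun p _ => ?_
  by_cases hp : p.primeCounting' = j
  · subst hp
    simp only [Function.update_self]
    fun_prop
  · simp only [Function.update_of_ne hp]
    fun_prop

variable {c : ℕ → ℂ} {N : ℕ} {M : ℝ}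

theorem norm_bohrPolynomial_circle_le
    (hM : ∀ t, ‖bohrPolynomial c N (fun j => (primeFlow t j : ℂ))‖ ≤ M) (z : ℕ → Circle) :
    ‖bohrPolynomial c N (fun j => (z j : ℂ))‖ ≤ M := by
  have hcont : Continuous fun z : ℕ → Circle => ‖bohrPolynomial c N (fun j => (z j : ℂ))‖ :=
    ((continuous_bohrPolynomial c N).comp (by fun_prop)).norm
  exact denseRange_primeFlow.induction_on (p := fun z : ℕ → Circle =>
    ‖bohrPolynomial c N (fun j => (z j : ℂ))‖ ≤ M) z (isClosed_le hcont continuous_const) hM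

/-- The maximum principle on the polydisk. -/
theorem norm_bohrPolynomial_le (hM : ∀ z : ℕ → Circle,
    ‖bohrPolynomial c N (fun j => (z j : ℂ))‖ ≤ M) {w : ℕ → ℂ} (hw : w ∈ closedPolydisk) :
    ‖bohrPolynomial c N w‖ ≤ M := by
  -- Induction on the coordinates allowed off the unit circle, freeing one at a time by the
  -- one-variable maximum principle.
  have key (S : Finset ℕ) : ∀ w ∈ closedPolydisk, (∀ j ∉ S, ‖w j‖ = 1) →
      ‖bohrPolynomial c N w‖ ≤ M := by
    induction S using Finset.induction_on with
    | empty =>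
      intro w _ hw
      exact hM fun j => ⟨w j, mem_sphere_zero_iff_norm.2 (hw j (Finset.notMem_empty j))⟩
    | insert j S hj ih =>
      intro w hw hwS
      have hdiff : Differentiable ℂ fun u => bohrPolynomial c N (Function.update w j u) :=
        Differentiable.fun_sum fun n _ => (differentiable_bohrMonomial_update n w j).const_mul _
      have h1 := Complex.norm_le_of_forall_mem_frontier_norm_le (U := Metric.ball (0 : ℂ) 1)
        Metric.isBounded_ball hdiff.diffContOnCl (C := M) (fun u hu => ?_) (z := w j) ?_
      · simpa using h1
      · rw [frontier_ball _ one_ne_zero, mem_sphere_zero_iff_norm] at hu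
        refine ih _ (fun i => ?_) fun i hi => ?_
        · rcases eq_or_ne i j with rfl | hij
          · simp [hu]
          · simpa [hij] using hw i
        · rcases eq_or_ne i j with rfl | hij
          · simpa using hu
          · rw [Function.update_of_ne hij]
            exact hwS i (by simp [hij, hi])
      · rw [closure_ball _ one_ne_zero, mem_closedBall_zero_iff]
        exact hw j
  let S : Finset ℕ := (Finset.range (N + 1)).image Nat.primeCounting'
  -- Coordinates that do not occur in the polynomial are moved to 1.
  let w' : ℕ → ℂ := fun j => if j ∈ S then w j else 1
  have heq : bohrPolynomial c N w = bohrPolynomial c N w' := by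
    refine Finset.sum_congr rfl fun n hn => ?_
    have hn' := Finset.mem_Icc.1 hn
    congr 1
    change n.factorization.prod _ = n.factorization.prod _
    refine Finsupp.prod_congr fun p hp => ?_
    have hpn : p ≤ n := Nat.le_of_mem_primeFactors hp
    have : p.primeCounting' ∈ S :=
      Finset.mem_image_of_mem _ (Finset.mem_range.2 (by omega))
    simp only [w', if_pos this]
  rw [heq]
  refine key S w' (fun j => ?_) fun j hj => by simp [w', hj]
  by_cases hj : j ∈ S
  · simpa [w', hj] using hw j
  · simp [w', hj]

/-- By orthogonality of characters, `c n` is a Fourier coefficient for Haar measure. -/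
theorem norm_coeff_le (hM : ∀ z : ℕ → Circle, ‖bohrPolynomial c N (fun j => (z j : ℂ))‖ ≤ M)
    {n : ℕ} (hn : n ∈ Finset.Icc 1 N) : ‖c n‖ ≤ M := by
  lift n to ℕ+ using (Finset.mem_Icc.1 hn).1
  let χ : (ℕ → Circle) → ℂ := fun z => star (bohrMonomial n (fun j => (z j : ℂ)))
  have hint : ∫ z, bohrPolynomial c N (fun j => (z j : ℂ)) * χ z ∂torusHaar = c n := by
    have hterm (m : ℕ) (hm : m ∈ Finset.Icc 1 N) :
        (Integrable (fun z => c m * bohrMonomial m (fun j => (z j : ℂ)) * χ z) torusHaar) ∧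
        ∫ z, c m * bohrMonomial m (fun j => (z j : ℂ)) * χ z ∂torusHaar
          = if m = n then c m else 0 := by
      lift m to ℕ+ using (Finset.mem_Icc.1 hm).1
      have h1 : (fun z : ℕ → Circle => c m * bohrMonomial m (fun j => (z j : ℂ)) * χ z)
          = fun z => c m * torusCharacter (m, n) z := by
        funext z
        simp [torusCharacter, χ, mul_assoc]
      rw [h1]
      refine ⟨(integrable_torusCharacter _ _).const_mul _, ?_⟩
      rw [integral_const_mul]
      split_ifs with hmn
      · obtain rfl := PNat.coe_injective hmn
        simp [torusCharacter_self]
      · rw [integral_torusCharacter_eq_zero (fun h => hmn (congrArg PNat.val h))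
          map_primeFlow_torusHaar, mul_zero]
    simp only [bohrPolynomial, Finset.sum_mul]
    rw [integral_finsetSum _ fun m hm => (hterm m hm).1,
      Finset.sum_congr rfl fun m hm => (hterm m hm).2, Finset.sum_ite_eq' _ _ c, if_pos hn]
  rw [← hint]
  refine (norm_integral_le_of_norm_le_const (C := M) (.of_forall fun z => ?_)).trans (by simp)
  rw [norm_mul, norm_star, norm_bohrMonomial_circle, mul_one]
  exact hM z

theorem mul_I_mem_closure_rightHalfPlane (t : ℝ) : t * Complex.I ∈ closure rightHalfPlane := by
  rw [rightHalfPlane, Complex.closure_setOfPred_lt_re]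
  simp

theorem continuous_dirichletPolynomial (c : ℕ → ℂ) (N : ℕ) :
    Continuous fun s : ℂ => ∑ n ∈ Finset.Icc 1 N, c n * (n : ℂ) ^ (-s) := by
  refine continuous_finsetSum _ fun n hn => continuous_const.mul ?_
  have hn0 : (n : ℂ) ≠ 0 := by
    have := (Finset.mem_Icc.1 hn).1
    exact_mod_cast (by omega : n ≠ 0)
  exact continuous_neg.const_cpow (Or.inl hn0)

/-- Bohr's inequality for Dirichlet polynomials. -/
theorem norm_bohrPolynomial_circle_le_of_halfPlane
    (hM : ∀ s ∈ rightHalfPlane, ‖∑ n ∈ Finset.Icc 1 N, c n * (n : ℂ) ^ (-s)‖ ≤ M)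
    (z : ℕ → Circle) : ‖bohrPolynomial c N (fun j => (z j : ℂ))‖ ≤ M := by
  refine norm_bohrPolynomial_circle_le (fun t => ?_) z
  rw [bohrPolynomial_primeFlow]
  exact closure_minimal hM (isClosed_le (continuous_dirichletPolynomial c N).norm continuous_const)
    (mul_I_mem_closure_rightHalfPlane t)

end BohrPolynomials

/-! ### The Bohr lift and the boundary values -/

section BohrLift

/-- Only integers composed of the finitely many primes with nonzero coordinate contribute, and their
sum is a finite Euler product of geometric series. -/
theorem summable_norm_bohrMonomial {w : ℕ → ℂ} (hw : w ∈ finitePolydisk) :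
    Summable fun n : ℕ+ => ‖bohrMonomial n w‖ := by
  -- `bohrMonomial 0 w` is 1, so the value at 0 is changed to keep `F` multiplicative.
  let F : ℕ →* ℂ :=
    { toFun := fun n => if n = 0 then 0 else bohrMonomial n w
      map_one' := by simp
      map_mul' := fun m n => by
        by_cases hm : m = 0
        · simp [hm]
        by_cases hn : n = 0
        · simp [hn]
        simp [hm, hn, bohrMonomial_mul hm hn] }
  let S : Finset ℕ := hw.2.toFinset.image (Nat.nth Nat.Prime)
  have h1 := (EulerProduct.summable_and_hasSum_factoredNumbers_prod_filter_prime_geometric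
    (f := F) (fun {p} hp => by
      change ‖if p = 0 then 0 else bohrMonomial p w‖ < 1
      rw [if_neg hp.ne_zero, bohrMonomial_prime hp]
      exact hw.1 _) S).1
  have h2 : Summable ((Nat.factoredNumbers S).indicator fun n => ‖F n‖) :=
    summable_subtype_iff_indicator.1 h1
  have h3 := h2.comp_injective PNat.coe_injective
  refine h3.congr fun n => ?_
  have hFn : F n = bohrMonomial n w := if_neg n.ne_zero
  by_cases hn : (n : ℕ) ∈ Nat.factoredNumbers S
  · simp [hn, hFn]
  · simp only [Function.comp_apply, Set.indicator_of_notMem hn]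
    rw [Nat.mem_factoredNumbers'] at hn
    push Not at hn
    obtain ⟨p, hp, hpn, hpS⟩ := hn
    have hw0 : w p.primeCounting' = 0 := by
      by_contra h
      refine hpS (Finset.mem_image.2 ⟨p.primeCounting', by simpa using h, Nat.nth_count hp⟩)
    rw [norm_bohrMonomial]
    refine (Finset.prod_eq_zero (i := p) (Nat.mem_primeFactors.2 ⟨hp, hpn, n.ne_zero⟩) ?_).symm
    simp only [hw0, norm_zero]
    exact zero_pow (hp.factorization_pos_of_dvd n.ne_zero hpn).ne'

theorem tsum_pnat_eq_bohrPolynomial {c : ℕ → ℂ} {N : ℕ} (hc : ∀ n, N < n → c n = 0)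
    (w : ℕ → ℂ) : ∑' n : ℕ+, c n * bohrMonomial n w = bohrPolynomial c N w := by
  rw [tsum_pnat_eq_tsum_succ (f := fun n => c n * bohrMonomial n w),
    tsum_eq_sum (s := Finset.range N), Finset.range_eq_Ico,
    Finset.sum_Ico_add' (fun n : ℕ => c n * bohrMonomial n w)]
  · rfl
  · intro k hk
    rw [hc (k + 1) (by simpa [Nat.lt_succ_iff] using hk), zero_mul]

namespace IsUniformDirichletSeries

variable {a : ℕ → ℂ} {f : ℂ → ℂ}

/-- The power series of a series in `𝒜(ℂ₊)` extends continuously to the closed polydisk, and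
the values of the extension along the prime flow are the boundary values of the series. -/
theorem exists_continuousOn_closedPolydisk (h : IsUniformDirichletSeries a f) :
    ∃ G : (ℕ → ℂ) → ℂ, ContinuousOn G closedPolydisk ∧
      (∀ w ∈ finitePolydisk, bohrPowerSeries a w = G w) ∧
      ∀ t : ℝ, Tendsto f (𝓝[rightHalfPlane] (t * Complex.I))
        (𝓝 (G fun j => (primeFlow t j : ℂ))) := by
  obtain ⟨c, N, hca, hc0, hcf⟩ := h.exists_dirichletPolynomial_approx
  obtain ⟨M, hM⟩ := h.exists_norm_le
  -- Bohr's inequality, applied to differences padded to a common length, carries the Cauchy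
  -- property from the half plane to the polydisk.
  have hcauchy : UniformCauchySeqOn (fun k => bohrPolynomial (c k) (N k)) atTop
      closedPolydisk := by
    rw [Metric.uniformCauchySeqOn_iff]
    intro ε hε
    obtain ⟨K, hK⟩ := Metric.uniformCauchySeqOn_iff.1 hcf.uniformCauchySeqOn (ε / 2) (half_pos hε)
    refine ⟨K, fun k hk l hl w hw => ?_⟩
    set L := max (N k) (N l) with hL
    have hsum (k : ℕ) (hkL : N k ≤ L) (s : ℂ) : ∑ n ∈ Finset.Icc 1 (N k), c k n * (n : ℂ) ^ (-s)
        = ∑ n ∈ Finset.Icc 1 L, c k n * (n : ℂ) ^ (-s) := by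
      refine Finset.sum_subset (Finset.Icc_subset_Icc_right hkL) fun n hn hn' => ?_
      rw [hc0 k n, zero_mul]
      simp only [Finset.mem_Icc] at hn hn'
      omega
    have h1 : ∀ s ∈ rightHalfPlane,
        ‖∑ n ∈ Finset.Icc 1 L, (c k - c l) n * (n : ℂ) ^ (-s)‖ ≤ ε / 2 := by
      intro s hs
      have := hK k hk l hl s hs
      rw [dist_eq_norm, hsum k (le_max_left _ _), hsum l (le_max_right _ _),
        ← Finset.sum_sub_distrib] at this
      simp only [Pi.sub_apply, sub_mul]
      exact this.le
    have h2 := norm_bohrPolynomial_le (norm_bohrPolynomial_circle_le_of_halfPlane h1) hw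
    rw [bohrPolynomial_sub, ← bohrPolynomial_eq_of_le (le_max_left _ _) (hc0 k),
      ← bohrPolynomial_eq_of_le (le_max_right _ _) (hc0 l)] at h2
    rw [dist_eq_norm]
    linarith
  have hlim (w : ℕ → ℂ) : ∃ x, w ∈ closedPolydisk →
      Tendsto (fun k => bohrPolynomial (c k) (N k) w) atTop (𝓝 x) := by
    by_cases hw : w ∈ closedPolydisk
    · obtain ⟨x, hx⟩ := cauchySeq_tendsto_of_complete (hcauchy.cauchySeq hw)
      exact ⟨x, fun _ => hx⟩
    · exact ⟨0, fun h => absurd h hw⟩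
  choose G hG using hlim
  have hunif : TendstoUniformlyOn (fun k => bohrPolynomial (c k) (N k)) G atTop closedPolydisk :=
    hcauchy.tendstoUniformlyOn_of_tendsto hG
  refine ⟨G, hunif.continuousOn (.of_forall fun k =>
    (continuous_bohrPolynomial _ _).continuousOn), fun w hw => ?_, fun t => ?_⟩
  -- The coefficients of the approximants are eventually bounded by `M + 1`, so dominated
  -- convergence identifies the limit with the power series.
  · have hbound : ∀ᶠ k in atTop, ∀ n : ℕ+,
        ‖c k n * bohrMonomial n w‖ ≤ (M + 1) * ‖bohrMonomial n w‖ := by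
      filter_upwards [Metric.tendstoUniformlyOn_iff.1 hcf 1 one_pos] with k hk n
      rw [norm_mul]
      gcongr
      have h1 : ∀ s ∈ rightHalfPlane,
          ‖∑ n ∈ Finset.Icc 1 (N k), c k n * (n : ℂ) ^ (-s)‖ ≤ M + 1 := by
        intro s hs
        have h2 := hk s hs
        rw [dist_comm, dist_eq_norm] at h2
        have h3 := norm_le_norm_add_norm_sub' (∑ n ∈ Finset.Icc 1 (N k), c k n * (n : ℂ) ^ (-s))
          (f s)
        linarith [hM s hs]
      by_cases hn : (n : ℕ) ∈ Finset.Icc 1 (N k)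
      · exact norm_coeff_le (norm_bohrPolynomial_circle_le_of_halfPlane h1) hn
      · rw [hc0 k n, norm_zero]
        · exact (norm_nonneg _).trans (h1 1 (by simp [rightHalfPlane]))
        · have := n.pos
          simp only [Finset.mem_Icc] at hn
          omega
    have h1 := tendsto_tsum_of_dominated_convergence
      ((summable_norm_bohrMonomial hw).mul_left (M + 1))
      (fun n : ℕ+ => (hca n n.ne_zero).mul_const (bohrMonomial n w)) hbound
    refine tendsto_nhds_unique h1
      ((hG w (finitePolydisk_subset_closedPolydisk hw)).congr fun k => ?_)
    exact (tsum_pnat_eq_bohrPolynomial (hc0 k) w).symm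
  -- Uniform convergence allows the limits `k → ∞` and `s → it` to be exchanged.
  · refine ((tendstoUniformlyOn_iff_tendstoUniformlyOnFilter.1 hcf).mono_right
      (inf_le_right : 𝓝[rightHalfPlane] (t * Complex.I) ≤ _))
      |>.tendsto_of_eventually_tendsto (.of_forall fun k =>
        ((continuous_dirichletPolynomial _ _).tendsto _).mono_left inf_le_left) ?_
    simp_rw [← bohrPolynomial_primeFlow]
    exact hG _ (circle_mem_closedPolydisk _)

theorem tendsto_boundaryValue (h : IsUniformDirichletSeries a f) (t : ℝ) :
    Tendsto f (𝓝[rightHalfPlane] (t * Complex.I)) (𝓝 (boundaryValue f t)) := by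
  obtain ⟨G, -, -, hf⟩ := h.exists_continuousOn_closedPolydisk
  exact tendsto_extendFrom ⟨_, hf t⟩

theorem tendsto_bohrLift (h : IsUniformDirichletSeries a f) (z : ℕ → Circle) :
    Tendsto (bohrPowerSeries a) (𝓝[finitePolydisk] (fun j => (z j : ℂ))) (𝓝 (bohrLift a z)) := by
  obtain ⟨G, hG, hP, -⟩ := h.exists_continuousOn_closedPolydisk
  refine tendsto_extendFrom ⟨G fun j => (z j : ℂ), ?_⟩
  refine ((hG _ (circle_mem_closedPolydisk z)).mono
    finitePolydisk_subset_closedPolydisk).congr' ?_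
  filter_upwards [self_mem_nhdsWithin] with w hw
  exact (hP w hw).symm

theorem bohrLift_eq (h : IsUniformDirichletSeries a f) {G : (ℕ → ℂ) → ℂ}
    (hG : ContinuousOn G closedPolydisk) (hP : ∀ w ∈ finitePolydisk, bohrPowerSeries a w = G w)
    (z : ℕ → Circle) : bohrLift a z = G fun j => (z j : ℂ) := by
  have := mem_closure_iff_nhdsWithin_neBot.1 (circle_mem_closure_finitePolydisk z)
  refine tendsto_nhds_unique (h.tendsto_bohrLift z) (((hG _ (circle_mem_closedPolydisk z)).mono
    finitePolydisk_subset_closedPolydisk).congr' ?_)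
  filter_upwards [self_mem_nhdsWithin] with w hw
  exact (hP w hw).symm

theorem continuous_bohrLift (h : IsUniformDirichletSeries a f) : Continuous (bohrLift a) := by
  obtain ⟨G, hG, hP, -⟩ := h.exists_continuousOn_closedPolydisk
  rw [funext (h.bohrLift_eq hG hP)]
  exact hG.comp_continuous (by fun_prop) circle_mem_closedPolydisk

theorem boundaryValue_eq (h : IsUniformDirichletSeries a f) (t : ℝ) :
    boundaryValue f t = bohrLift a (primeFlow t) := by
  obtain ⟨G, hG, hP, hf⟩ := h.exists_continuousOn_closedPolydisk
  rw [h.bohrLift_eq hG hP]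
  exact extendFrom_eq (mul_I_mem_closure_rightHalfPlane t) (hf t)

theorem continuous_boundaryValue (h : IsUniformDirichletSeries a f) :
    Continuous (boundaryValue f) := by
  rw [funext h.boundaryValue_eq]
  exact h.continuous_bohrLift.comp continuous_primeFlow

end IsUniformDirichletSeries

end BohrLift

/-! ### Quadratic means and polarization -/

section QuadraticMeans

theorem lipschitzOnWith_natCast_cpow_neg (n : ℕ+) :
    LipschitzOnWith (Real.log n).toNNReal (fun s : ℂ => (n : ℂ) ^ (-s)) rightHalfPlane := by
  have hn0 : (n : ℂ) ≠ 0 := by exact_mod_cast n.ne_zero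
  have hn1 : (1 : ℝ) ≤ n := by exact_mod_cast n.pos
  refine convex_rightHalfPlane.lipschitzOnWith_of_nnnorm_hasDerivWithin_le
    (f' := fun s => (n : ℂ) ^ (-s) * Complex.log n * -1)
    (fun s _ => ((hasDerivAt_neg s).const_cpow (Or.inl hn0)).hasDerivWithinAt) fun s hs => ?_
  have hs0 : 0 < s.re := hs
  rw [← NNReal.coe_le_coe, coe_nnnorm, Real.coe_toNNReal _ (Real.log_nonneg hn1), norm_mul,
    norm_mul, Complex.norm_natCast_cpow_of_pos n.pos, ← Complex.natCast_log, Complex.norm_real,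
    Real.norm_of_nonneg (Real.log_nonneg hn1)]
  simp only [norm_neg, norm_one, mul_one]
  exact mul_le_of_le_one_left (Real.log_nonneg hn1)
    (Real.rpow_le_one_of_one_le_of_nonpos hn1 (by simpa using hs0.le))

/-- The Dirichlet polynomial `m ^ (-s) + c * n ^ (-s)`. -/
noncomputable def dirichletBinomial (q : ℕ+ × ℕ+) (c : ℂ) (s : ℂ) : ℂ :=
  (q.1 : ℂ) ^ (-s) + c * (q.2 : ℂ) ^ (-s)

/-- The coefficients of `dirichletBinomial`. -/
noncomputable def dirichletBinomialCoeff (q : ℕ+ × ℕ+) (c : ℂ) : ℕ → ℂ :=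
  Pi.single (q.1 : ℕ) 1 + Pi.single (q.2 : ℕ) c

theorem isUniformDirichletSeries_dirichletBinomial (q : ℕ+ × ℕ+) (c : ℂ) :
    IsUniformDirichletSeries (dirichletBinomialCoeff q c) (dirichletBinomial q c) where
  converges s _ := by
    refine tendsto_const_nhds.congr' ?_
    filter_upwards [eventually_ge_atTop (q.1 : ℕ), eventually_ge_atTop (q.2 : ℕ)] with N h1 h2
    have hsingle (n : ℕ+) (hn : (n : ℕ) ≤ N) (d : ℂ) : ∑ k ∈ Finset.Icc 1 N,
        (Pi.single (n : ℕ) d : ℕ → ℂ) k * (k : ℂ) ^ (-s) = d * (n : ℂ) ^ (-s) := by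
      rw [Finset.sum_eq_single (n : ℕ)]
      · rw [Pi.single_eq_same]
      · intro k _ hk
        rw [Pi.single_eq_of_ne hk, zero_mul]
      · intro h
        exact absurd (Finset.mem_Icc.2 ⟨n.pos, hn⟩) h
    simp only [dirichletBinomialCoeff, Pi.add_apply, add_mul, Finset.sum_add_distrib]
    rw [hsingle _ h1, hsingle _ h2, one_mul, dirichletBinomial]
  uniformContinuousOn := by
    have hn (n : ℕ+) := uniformContinuousOn_iff_restrict.1
      (lipschitzOnWith_natCast_cpow_neg n).uniformContinuousOn
    exact uniformContinuousOn_iff_restrict.2 ((hn q.1).add ((hn q.2).const_smul c))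

/-- Both sides are continuous and agree along the dense flow, where they are boundary values. -/
theorem bohrLift_dirichletBinomial (q : ℕ+ × ℕ+) (c : ℂ) (z : ℕ → Circle) :
    bohrLift (dirichletBinomialCoeff q c) z
      = bohrMonomial q.1 (fun j => (z j : ℂ)) + c * bohrMonomial q.2 (fun j => (z j : ℂ)) := by
  have h := isUniformDirichletSeries_dirichletBinomial q c
  have hcont : Continuous fun z : ℕ → Circle =>
      bohrMonomial q.1 (fun j => (z j : ℂ)) + c * bohrMonomial q.2 (fun j => (z j : ℂ)) :=
    ((continuous_bohrMonomial _).comp (by fun_prop)).add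
      (continuous_const.mul ((continuous_bohrMonomial _).comp (by fun_prop)))
  refine congrFun (denseRange_primeFlow.equalizer h.continuous_bohrLift hcont ?_) z
  funext t
  have hf : Continuous (dirichletBinomial q c) := by
    have hq (n : ℕ+) : (n : ℂ) ≠ 0 := by exact_mod_cast n.ne_zero
    exact (continuous_neg.const_cpow (Or.inl (hq _))).add
      (continuous_const.mul (continuous_neg.const_cpow (Or.inl (hq _))))
  simp only [Function.comp_apply]
  rw [← h.boundaryValue_eq, boundaryValue, extendFrom_eq (mul_I_mem_closure_rightHalfPlane t)
    ((hf.tendsto _).mono_left nhdsWithin_le_nhds), dirichletBinomial,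
    bohrMonomial_primeFlow q.1.ne_zero, bohrMonomial_primeFlow q.2.ne_zero]

/-- Polarization. -/
theorem torusCharacter_eq_normSq_bohrLift (q : ℕ+ × ℕ+) (z : ℕ → Circle) :
    torusCharacter q z = 2⁻¹ * (((‖bohrLift (dirichletBinomialCoeff q 1) z‖ ^ 2 : ℝ) - 2) +
      Complex.I * ((‖bohrLift (dirichletBinomialCoeff q Complex.I) z‖ ^ 2 : ℝ) - 2)) := by
  rw [bohrLift_dirichletBinomial, bohrLift_dirichletBinomial, torusCharacter]
  have h1 := norm_bohrMonomial_circle q.1 z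
  have h2 := norm_bohrMonomial_circle q.2 z
  set x := bohrMonomial q.1 (fun j => (z j : ℂ))
  set y := bohrMonomial q.2 (fun j => (z j : ℂ))
  have hx : x * star x = 1 := by simp [RCLike.star_def, Complex.mul_conj', h1]
  have hy : y * star y = 1 := by simp [RCLike.star_def, Complex.mul_conj', h2]
  -- For unimodular `x`, `y`: `|x + y|^2 - 2 = 2 Re (x ȳ)` and `|x + iy|^2 - 2 = 2 Im (x ȳ)`.
  simp only [Complex.ofReal_pow, ← Complex.mul_conj', ← RCLike.star_def, star_add, star_mul']
  have hI : star Complex.I = -Complex.I := Complex.conj_I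
  rw [hI, star_one]
  linear_combination (-(1 + Complex.I) / 2) * hx - (1 - Complex.I ^ 3) / 2 * hy
    + (star y * x - y * star x) / 2 * Complex.I_sq + Complex.I / 2 * Complex.I_sq

theorem integral_torusCharacter_eq (q : ℕ+ × ℕ+) (μ : Measure (ℕ → Circle))
    [IsProbabilityMeasure μ] :
    ∫ z, torusCharacter q z ∂μ
      = 2⁻¹ * (((∫ z, ‖bohrLift (dirichletBinomialCoeff q 1) z‖ ^ 2 ∂μ : ℝ) - 2) +
      Complex.I * ((∫ z, ‖bohrLift (dirichletBinomialCoeff q Complex.I) z‖ ^ 2 ∂μ : ℝ) - 2)) := by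
  have hint (c : ℂ) : Integrable
      (fun z => ((‖bohrLift (dirichletBinomialCoeff q c) z‖ ^ 2 : ℝ) : ℂ)) μ := by
    have hcont : Continuous
        (fun z => ((‖bohrLift (dirichletBinomialCoeff q c) z‖ ^ 2 : ℝ) : ℂ)) :=
      Complex.continuous_ofReal.comp
        ((isUniformDirichletSeries_dirichletBinomial q c).continuous_bohrLift.norm.pow 2)
    exact (BoundedContinuousFunction.mkOfCompact ⟨_, hcont⟩).integrable μ
  have hsub (c : ℂ) : Integrable
      (fun z => ((‖bohrLift (dirichletBinomialCoeff q c) z‖ ^ 2 : ℝ) : ℂ) - 2) μ :=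
    (hint c).sub (integrable_const _)
  simp_rw [torusCharacter_eq_normSq_bohrLift]
  rw [integral_const_mul, integral_add (hsub 1) ((hsub Complex.I).const_mul _),
    integral_const_mul, integral_sub (hint 1) (integrable_const _),
    integral_sub (hint _) (integrable_const _), integral_complex_ofReal,
    integral_complex_ofReal]
  simp

theorem eq_of_hasQuadraticMean {ν : Measure ℝ} {μ μ' : Measure (ℕ → Circle)} [IsProbabilityMeasure μ]
    [IsProbabilityMeasure μ']
    (h : ∀ (a : ℕ → ℂ) (f : ℂ → ℂ), IsUniformDirichletSeries a f →
      HasQuadraticMean ν f (∫ z, ‖bohrLift a z‖ ^ 2 ∂μ))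
    (h' : ∀ (a : ℕ → ℂ) (f : ℂ → ℂ), IsUniformDirichletSeries a f →
      HasQuadraticMean ν f (∫ z, ‖bohrLift a z‖ ^ 2 ∂μ')) : μ = μ' := by
  refine ext_of_integral_torusCharacter_eq fun q => ?_
  have heq (c : ℂ) := tendsto_nhds_unique
    (h _ _ (isUniformDirichletSeries_dirichletBinomial q c)).2
    (h' _ _ (isUniformDirichletSeries_dirichletBinomial q c)).2
  rw [integral_torusCharacter_eq, integral_torusCharacter_eq, heq, heq]

variable {ν : Measure ℝ} [IsLocallyFiniteMeasure ν] {a : ℕ → ℂ} {f : ℂ → ℂ}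

theorem IsUniformDirichletSeries.hasQuadraticMean_iff (h : IsUniformDirichletSeries a f) {L : ℝ} :
    HasQuadraticMean ν f L ↔ (∀ᶠ T : ℝ in atTop, 0 < ν (Set.Icc 0 T)) ∧
      Tendsto (fun T => ∫ z, ‖bohrLift a z‖ ^ 2 ∂(primeFlowLaw ν T)) atTop (𝓝 L) := by
  refine and_congr_right fun hν => tendsto_congr' ?_
  filter_upwards [hν] with T hT
  have hcont : Continuous fun z => ‖bohrLift a z‖ ^ 2 := h.continuous_bohrLift.norm.pow 2
  rw [integral_primeFlowLaw hT hcont]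
  simp_rw [h.boundaryValue_eq]
  rfl

theorem IsUniformDirichletSeries.hasQuadraticMean (h : IsUniformDirichletSeries a f)
    (hν : ∀ᶠ T : ℝ in atTop, 0 < ν (Set.Icc 0 T)) {μ : ProbabilityMeasure (ℕ → Circle)}
    (hμ : Tendsto (primeFlowLaw ν) atTop (𝓝 μ)) :
    HasQuadraticMean ν f (∫ z, ‖bohrLift a z‖ ^ 2 ∂μ) :=
  h.hasQuadraticMean_iff.2 ⟨hν, ProbabilityMeasure.tendsto_iff_forall_integral_tendsto.1 hμ
    (BoundedContinuousFunction.mkOfCompact ⟨_, h.continuous_bohrLift.norm.pow 2⟩)⟩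

/-- By polarization, the means of the binomials alone force every Fourier coefficient of the laws to
converge. -/
theorem exists_tendsto_primeFlowLaw
    (H : ∀ (a : ℕ → ℂ) (f : ℂ → ℂ), IsUniformDirichletSeries a f → ∃ L, HasQuadraticMean ν f L) :
    ∃ μ, Tendsto (primeFlowLaw ν) atTop (𝓝 μ) := by
  have hb (q : ℕ+ × ℕ+) (c : ℂ) := isUniformDirichletSeries_dirichletBinomial q c
  choose L hL using fun q c => H _ _ (hb q c)
  have key (q : ℕ+ × ℕ+) : Tendsto (fun T => ∫ z, torusCharacter q z ∂(primeFlowLaw ν T)) atTop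
      (𝓝 (2⁻¹ * (((L q 1 : ℝ) - 2) + Complex.I * ((L q Complex.I : ℝ) - 2)))) := by
    have hlim (c : ℂ) := (Complex.continuous_ofReal.tendsto _).comp
      ((hb q c).hasQuadraticMean_iff.1 (hL q c)).2
    simp_rw [integral_torusCharacter_eq]
    exact (((hlim 1).sub_const 2).add (((hlim Complex.I).sub_const 2).const_mul _)).const_mul _
  obtain ⟨μ, hμ⟩ := exists_probabilityMeasure_integral_torusCharacter_eq key
  refine ⟨μ, tendsto_probabilityMeasure_of_tendsto_integral_torusCharacter fun q => ?_⟩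
  rw [hμ]
  exact key q

end QuadraticMeans

theorem theorem4 :
    -- the boundary values `f(it)` and the Bohr lift `F` are well defined, and continuous
    (∀ (a : ℕ → ℂ) (f : ℂ → ℂ), IsUniformDirichletSeries a f →
      (∀ t : ℝ, Tendsto f (𝓝[rightHalfPlane] (t * Complex.I)) (𝓝 (boundaryValue f t))) ∧
      Continuous (boundaryValue f) ∧
      (∀ z : ℕ → Circle, Tendsto (bohrPowerSeries a)
        (𝓝[finitePolydisk] (fun j => (z j : ℂ))) (𝓝 (bohrLift a z))) ∧
      Continuous (bohrLift a)) ∧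
    -- (i)
    (∀ μ : Measure (ℕ → Circle), IsProbabilityMeasure μ →
      ∃ ν : Measure ℝ, IsLocallyFiniteMeasure ν ∧
        ∀ (a : ℕ → ℂ) (f : ℂ → ℂ), IsUniformDirichletSeries a f →
          HasQuadraticMean ν f (∫ z, ‖bohrLift a z‖ ^ 2 ∂μ)) ∧
    -- (ii)
    (∀ ν : Measure ℝ, IsLocallyFiniteMeasure ν →
      (∀ (a : ℕ → ℂ) (f : ℂ → ℂ), IsUniformDirichletSeries a f →
        ∃ L : ℝ, HasQuadraticMean ν f L) →
      ∃! μ : Measure (ℕ → Circle), IsProbabilityMeasure μ ∧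
        ∀ (a : ℕ → ℂ) (f : ℂ → ℂ), IsUniformDirichletSeries a f →
          HasQuadraticMean ν f (∫ z, ‖bohrLift a z‖ ^ 2 ∂μ)) := by

  refine ⟨fun a f h => ⟨h.tendsto_boundaryValue, h.continuous_boundaryValue, h.tendsto_bohrLift,
    h.continuous_bohrLift⟩, fun μ hμ => ?_, fun ν hν H => ?_⟩
  · obtain ⟨ν, hν, hpos, hlim⟩ := exists_measure_tendsto_primeFlowLaw ⟨μ, hμ⟩
    exact ⟨ν, hν, fun a f h => h.hasQuadraticMean hpos hlim⟩
  · obtain ⟨μ, hμ⟩ := exists_tendsto_primeFlowLaw H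
    have hpos : ∀ᶠ T : ℝ in atTop, 0 < ν (Set.Icc 0 T) := by
      obtain ⟨L, hL⟩ := H _ _ (isUniformDirichletSeries_dirichletBinomial 1 1)
      exact hL.1
    have hmean : ∀ (a : ℕ → ℂ) (f : ℂ → ℂ), IsUniformDirichletSeries a f →
        HasQuadraticMean ν f (∫ z, ‖bohrLift a z‖ ^ 2 ∂(μ : Measure (ℕ → Circle))) :=
      fun a f h => h.hasQuadraticMean hpos hμ
    refine ⟨μ, ⟨inferInstance, hmean⟩, fun μ' hμ' => ?_⟩
    have := hμ'.1
    exact eq_of_hasQuadraticMean hμ'.2 hmean
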